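/- Let $R$ be an integer with $|R|\ge 2$, let $b$ be a nonzero integer and $B=\{0,b\}$. Let $L\subset\mathbb Z$ be a finite set with $0\in L$, and let $(\alpha_l)_{l\in L}$ be nonzero complex numbers with $\alpha_0=1$. Let $\mu=\mu(R,B)$ be the unique Borel probability measure on $\mathbb R$ with $$\mu(E)=\tfrac12\big(\mu(\tau_0^{-1}E)+\mu(\tau_b^{-1}E)\big)\quad\text{for all Borel sets }E,\qquad \tau_c(x)=R^{-1}(x+c),$$ and for $\lambda\in\mathbb R$ put $e_\lambda(x)=e^{2\pi i\lambda x}$. The matrix $$T=\frac1{\sqrt2}\Big(e^{2\pi i R^{-1}lc}\,\alpha_l\Big)_{l\in L,\;c\in B}$$ is an isometry, i.e. $T^*T=I$, if and only if the following four conditions hold: (i) $R=2^{\alpha}r$ with $\alpha\ge 1$ an integer and $r$ an odd integer; (ii) $b=2^{\beta}q$ with $\beta$ an integer, $0\le\beta\le\alpha-1$, and $q$ an odd integer; (iii) every $l\in L\setminus\{0\}$ is of the form $l=2^{\alpha-1-\beta}s$ with $s$ odd and $qs$ divisible by $r$; (iv) $\sum_{l\in L\setminus\{0\}}|\alpha_l|^2=1$.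 If, in addition to (i)–(iv), (v) there exist $l_1,l_2\in L\setminus\{0\}$ with $l_1\not\equiv l_2\pmod R$, then the family $$\Big(\prod_{j=0}^{k}\alpha_{l_j}\Big)\,e_{l_0+Rl_1+\dots+R^kl_k},$$ indexed by all finite words $l_0l_1\dots l_k$ with digits in $L$ that are either empty or have last digit $l_k\ne0$ (the empty word contributes $e_0=1$), is a Parseval frame for $L^2(\mu)$: for every $v\in L^2(\mu)$ the sum of $|\langle v,f\rangle|^2$ over the members $f$ of the family equals $\|v\|^2$. -/

import Mathlib

open MeasureTheory ProbabilityTheory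

noncomputable section

namespace WeightedFourier

/-- `μ` is self-affine (with equal weights) for the iterated function system
`τ_b x = R⁻¹ (x + b)`, `b ∈ B`: for every Borel set `E`,
`μ E = (1 / #B) ∑_{b ∈ B} μ (τ_b⁻¹ E)`. -/
def IsSelfAffine (R : ℤ) (B : Finset ℤ) (μ : Measure ℝ) : Prop :=
  ∀ E : Set ℝ, MeasurableSet E →
    μ E = (B.card : ENNReal)⁻¹ *
      ∑ b ∈ B, μ ((fun x : ℝ => (R : ℝ)⁻¹ * (x + (b : ℝ))) ⁻¹' E)

/-- The point `∑_{k ≥ 1} R^{-k} b_k` coded by a sequence of digits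
(written with `k` shifted by one). -/
def codingMap (R : ℤ) (B : Finset ℤ) (ω : ℕ → B) : ℝ :=
  ∑' k : ℕ, ((R : ℝ)⁻¹) ^ (k + 1) * ((ω k : ℤ) : ℝ)

/-- The self-affine measure `μ(R, B)`: the law of `∑_{k ≥ 1} R^{-k} b_k` where the digits `b_k`
are independent and uniformly distributed on `B`. For `|R| ≥ 2` it is the unique
self-affine probability measure, see `existsUnique_isSelfAffine` and
`isSelfAffine_selfAffineMeasure` below. -/
def selfAffineMeasure (R : ℤ) (B : Finset ℤ) [Nonempty B] : Measure ℝ :=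
  (Measure.infinitePi (fun _ : ℕ => uniformOn (Set.univ : Set B))).map (codingMap R B)

instance isFiniteMeasure_selfAffineMeasure (R : ℤ) (B : Finset ℤ) [Nonempty B] :
    IsFiniteMeasure (selfAffineMeasure R B) := by
  unfold selfAffineMeasure; infer_instance

instance nonempty_pair (b : ℤ) : Nonempty ({0, b} : Finset ℤ) := ⟨⟨0, by simp⟩⟩

section SelfAffine

variable {R : ℤ} {B : Finset ℤ}

lemma abs_inv_lt_one (hR : 2 ≤ |R|) : |(R : ℝ)⁻¹| < 1 := by
  have h : (2 : ℝ) ≤ |(R : ℝ)| := by exact_mod_cast hR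
  rw [abs_inv]
  exact inv_lt_one_of_one_lt₀ (by linarith)

lemma summable_coding (hR : 2 ≤ |R|) (ω : ℕ → B) :
    Summable (fun k : ℕ => ((R : ℝ)⁻¹) ^ (k + 1) * ((ω k : ℤ) : ℝ)) := by
  have h1 := abs_inv_lt_one hR
  have hs : Summable (fun k : ℕ => |(R : ℝ)⁻¹| ^ (k + 1) * (∑ b ∈ B, |(b : ℝ)|)) :=
    (((summable_nat_add_iff 1).2 (summable_geometric_of_lt_one (abs_nonneg _) h1))).mul_right _
  refine Summable.of_norm_bounded hs (fun k => ?_)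
  rw [norm_mul, norm_pow, Real.norm_eq_abs, Real.norm_eq_abs]
  refine mul_le_mul_of_nonneg_left ?_ (by positivity)
  exact Finset.single_le_sum (f := fun b : ℤ => |(b : ℝ)|) (fun _ _ => abs_nonneg _) (ω k).2

lemma measurable_codingMap (hR : 2 ≤ |R|) : Measurable (codingMap R B) := by
  refine measurable_of_tendsto_metrizable
    (f := fun (n : ℕ) (ω : ℕ → B) =>
      ∑ k ∈ Finset.range n, ((R : ℝ)⁻¹) ^ (k + 1) * ((ω k : ℤ) : ℝ)) (fun n => ?_) ?_
  · refine Finset.measurable_sum _ (fun k _ => ?_)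
    have : Measurable (fun b : B => ((b : ℤ) : ℝ)) := measurable_of_countable _
    exact (this.comp (measurable_pi_apply k)).const_mul _
  · rw [tendsto_pi_nhds]
    exact fun ω => (summable_coding hR ω).hasSum.tendsto_sum_nat

/-- Prepend a digit to a sequence of digits. -/
def consDigit (p : B × (ℕ → B)) : ℕ → B := fun n => Nat.casesOn n p.1 p.2

lemma codingMap_consDigit (hR : 2 ≤ |R|) (p : B × (ℕ → B)) :
    codingMap R B (consDigit p) = (R : ℝ)⁻¹ * (codingMap R B p.2 + ((p.1 : ℤ) : ℝ)) := by
  unfold codingMap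
  rw [(summable_coding hR (consDigit p)).tsum_eq_zero_add, mul_add, ← tsum_mul_left, add_comm]
  congr 1
  · refine tsum_congr fun k => ?_
    simp only [consDigit]
    ring
  · simp [consDigit]

lemma measurable_consDigit : Measurable (consDigit : B × (ℕ → B) → ℕ → B) := by
  refine measurable_pi_lambda _ (fun n => ?_)
  cases n with
  | zero => exact measurable_fst
  | succ n => exact (measurable_pi_apply n).comp measurable_snd

lemma map_consDigit (ν : Measure B) [IsProbabilityMeasure ν] :
    (ν.prod (Measure.infinitePi (fun _ : ℕ => ν))).map consDigit
      = Measure.infinitePi (fun _ : ℕ => ν) := by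
  classical
  refine Measure.eq_infinitePi _ (fun s t ht => ?_)
  set t' : ℕ → Set B := fun i => if i ∈ s then t i else Set.univ with ht'
  have hmt' : ∀ i, MeasurableSet (t' i) := fun i => by
    simp only [ht']; split_ifs <;> [exact ht i; exact .univ]
  obtain ⟨n, hn⟩ : ∃ n, s ⊆ Finset.range (n + 1) :=
    ⟨s.sup id, fun i hi => Finset.mem_range.2 (Nat.lt_succ_of_le (Finset.le_sup (f := id) hi))⟩
  have hset : consDigit ⁻¹' ((s : Set ℕ).pi t)
      = (t' 0) ×ˢ (((Finset.range n : Finset ℕ) : Set ℕ).pi (fun i => t' (i + 1))) := by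
    ext ⟨b, ω⟩
    simp only [Set.mem_preimage, Set.mem_pi, Finset.mem_coe, Set.mem_prod, Finset.mem_range, ht']
    constructor
    · intro h
      refine ⟨?_, fun i _ => ?_⟩
      · split_ifs with h0
        · exact h 0 h0
        · trivial
      · split_ifs with h0
        · exact h (i + 1) h0
        · trivial
    · rintro ⟨h0, h1⟩ i hi
      cases i with
      | zero => simpa [hi, consDigit] using h0
      | succ i =>
        have := h1 i (by have := Finset.mem_range.1 (hn hi); omega)
        simpa [hi, consDigit] using this
  rw [Measure.map_apply measurable_consDigit
    (MeasurableSet.pi s.countable_toSet (fun i _ => ht i)), hset, Measure.prod_prod,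
    Measure.infinitePi_pi _ (fun i _ => hmt' (i + 1))]
  have h2 : ∏ i ∈ Finset.range (n + 1), ν (t' i) = ∏ i ∈ s, ν (t i) := by
    rw [← Finset.prod_subset hn]
    · exact Finset.prod_congr rfl fun i hi => by simp [ht', hi]
    · intro i _ hi
      simp [ht', hi]
  rw [← h2, Finset.prod_range_succ', mul_comm]

lemma isProbabilityMeasure_selfAffineMeasure [Nonempty B] (hR : 2 ≤ |R|) :
    IsProbabilityMeasure (selfAffineMeasure R B) :=
  Measure.isProbabilityMeasure_map (measurable_codingMap hR).aemeasurable

lemma isSelfAffine_selfAffineMeasure [Nonempty B] (hR : 2 ≤ |R|) :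
    IsSelfAffine R B (selfAffineMeasure R B) := by
  intro E hE
  have hX := measurable_codingMap (B := B) hR
  have hτ : ∀ b : B, MeasurableSet ((fun x : ℝ => (R : ℝ)⁻¹ * (x + ((b : ℤ) : ℝ))) ⁻¹' E) :=
    fun b => (by fun_prop : Measurable fun x : ℝ => (R : ℝ)⁻¹ * (x + ((b : ℤ) : ℝ))) hE
  unfold selfAffineMeasure
  rw [Measure.map_apply hX hE, ← map_consDigit,
    Measure.map_apply measurable_consDigit (hX hE),
    Measure.prod_apply (measurable_consDigit (hX hE)), map_consDigit, lintegral_fintype]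
  have h1 : ∀ b : B, uniformOn (Set.univ : Set B) {b} = (B.card : ENNReal)⁻¹ := by
    intro b
    rw [uniformOn_univ]
    simp
  simp only [h1]
  rw [Finset.mul_sum, ← Finset.sum_coe_sort B]
  refine Finset.sum_congr rfl fun b _ => ?_
  rw [mul_comm, Measure.map_apply hX (hτ b)]
  congr 2
  ext ω
  simp only [Set.mem_preimage]
  rw [codingMap_consDigit hR]

lemma IsSelfAffine.charFun_eq {μ : Measure ℝ} [IsProbabilityMeasure μ] (h : IsSelfAffine R B μ)
    (t : ℝ) :
    charFun μ t = (B.card : ℂ)⁻¹ *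
      ∑ b ∈ B, Complex.exp ((R : ℝ)⁻¹ * t * b * Complex.I) * charFun μ ((R : ℝ)⁻¹ * t) := by
  have hτ : ∀ b : ℤ, Measurable fun x : ℝ => (R : ℝ)⁻¹ * (x + (b : ℝ)) := fun b => by fun_prop
  have hμ : μ = (B.card : ENNReal)⁻¹ •
      ∑ b ∈ B, μ.map (fun x : ℝ => (R : ℝ)⁻¹ * (x + (b : ℝ))) := by
    ext E hE
    rw [h E hE, Measure.smul_apply, Measure.finsetSum_apply, smul_eq_mul]
    congr 1
    exact Finset.sum_congr rfl fun b _ => by rw [Measure.map_apply (hτ b) hE]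
  conv_lhs => rw [hμ]
  have hbd : ∀ ρ : Measure ℝ, IsProbabilityMeasure ρ →
      Integrable (fun x : ℝ => Complex.exp (t * x * Complex.I)) ρ := by
    intro ρ _
    refine Integrable.of_bound (C := 1) (by fun_prop) (Filter.Eventually.of_forall fun x => ?_)
    rw [← Complex.ofReal_mul, Complex.norm_exp_ofReal_mul_I]
  rw [charFun_apply_real, integral_smul_measure, integral_finsetSum_measure]
  · simp only [ENNReal.toReal_inv, ENNReal.toReal_natCast, Complex.real_smul, Complex.ofReal_inv,
      Complex.ofReal_natCast]
    congr 1
    refine Finset.sum_congr rfl fun b _ => ?_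
    rw [integral_map (hτ b).aemeasurable (by fun_prop), charFun_apply_real, ← integral_const_mul]
    refine integral_congr_ae (Filter.Eventually.of_forall fun x => ?_)
    simp only
    rw [← Complex.exp_add]
    congr 1
    push_cast
    ring
  · intro b _
    exact hbd _ (Measure.isProbabilityMeasure_map (hτ b).aemeasurable)

lemma IsSelfAffine.unique (hR : 2 ≤ |R|) {μ ν : Measure ℝ} [IsProbabilityMeasure μ]
    [IsProbabilityMeasure ν] (hμ : IsSelfAffine R B μ) (hν : IsSelfAffine R B ν) : μ = ν := by
  refine Measure.ext_of_charFun (funext fun t => ?_)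
  set D : ℝ → ℂ := fun t => charFun μ t - charFun ν t with hD
  have step : ∀ t, ‖D t‖ ≤ ‖D ((R : ℝ)⁻¹ * t)‖ := by
    intro t
    have : D t = (B.card : ℂ)⁻¹ *
        ∑ b ∈ B, Complex.exp ((R : ℝ)⁻¹ * t * b * Complex.I) * D ((R : ℝ)⁻¹ * t) := by
      simp only [hD]
      rw [hμ.charFun_eq t, hν.charFun_eq t, ← mul_sub, ← Finset.sum_sub_distrib]
      simp only [mul_sub]
    rw [this, norm_mul, norm_inv, Complex.norm_natCast]
    calc (B.card : ℝ)⁻¹ * ‖∑ b ∈ B, Complex.exp ((R : ℝ)⁻¹ * t * b * Complex.I)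
            * D ((R : ℝ)⁻¹ * t)‖
        ≤ (B.card : ℝ)⁻¹ * ∑ b ∈ B, ‖D ((R : ℝ)⁻¹ * t)‖ := by
          refine mul_le_mul_of_nonneg_left (norm_sum_le_of_le _ fun b _ => ?_) (by positivity)
          rw [norm_mul]
          have : (((R : ℝ)⁻¹ : ℝ) : ℂ) * t * b * Complex.I
              = (((R : ℝ)⁻¹ * t * b : ℝ) : ℂ) * Complex.I := by push_cast; ring
          rw [this, Complex.norm_exp_ofReal_mul_I, one_mul]
      _ ≤ ‖D ((R : ℝ)⁻¹ * t)‖ := by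
          rw [Finset.sum_const, nsmul_eq_mul, ← mul_assoc]
          exact mul_le_of_le_one_left (norm_nonneg _) (inv_mul_le_one)
  have iter : ∀ n : ℕ, ‖D t‖ ≤ ‖D (((R : ℝ)⁻¹) ^ n * t)‖ := by
    intro n
    induction n with
    | zero => simp
    | succ n ih =>
      refine ih.trans ((step _).trans (le_of_eq ?_))
      rw [← mul_assoc, ← pow_succ']
  have hcont : Continuous D := continuous_charFun.sub continuous_charFun
  have hlim : Filter.Tendsto (fun n : ℕ => ‖D (((R : ℝ)⁻¹) ^ n * t)‖) Filter.atTop (nhds 0) := by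
    have h0 : Filter.Tendsto (fun n : ℕ => ((R : ℝ)⁻¹) ^ n * t) Filter.atTop (nhds 0) := by
      simpa using (tendsto_pow_atTop_nhds_zero_of_abs_lt_one (abs_inv_lt_one hR)).mul_const t
    have := (hcont.norm.tendsto 0).comp h0
    simpa [hD, charFun_zero, Function.comp_def] using this
  have h0 : ‖D t‖ ≤ 0 := ge_of_tendsto' hlim iter
  exact sub_eq_zero.1 (norm_le_zero_iff.1 h0)

/-- `μ(R, B)` is the unique self-affine probability measure. -/
lemma existsUnique_isSelfAffine [Nonempty B] (hR : 2 ≤ |R|) :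
    ∃! μ : Measure ℝ, IsProbabilityMeasure μ ∧ IsSelfAffine R B μ := by
  have := isProbabilityMeasure_selfAffineMeasure (B := B) hR
  refine ⟨selfAffineMeasure R B, ⟨this, isSelfAffine_selfAffineMeasure hR⟩, ?_⟩
  rintro ν ⟨_, hν⟩
  exact hν.unique hR (isSelfAffine_selfAffineMeasure hR)

end SelfAffine

/-- The exponential function `e_t x = exp (2 π i t x)` on the real line. -/
def expFun (t : ℝ) (x : ℝ) : ℂ := Complex.exp (2 * Real.pi * Complex.I * t * x)

lemma memLp_expFun (μ : Measure ℝ) [IsFiniteMeasure μ] (t : ℝ) : MemLp (expFun t) 2 μ := by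
  refine MemLp.of_bound (by unfold expFun; fun_prop) 1 (Filter.Eventually.of_forall fun x => ?_)
  have : expFun t x = Complex.exp (((2 * Real.pi * t * x : ℝ) : ℂ) * Complex.I) := by
    unfold expFun; congr 1; push_cast; ring
  rw [this, Complex.norm_exp_ofReal_mul_I]

/-- `e_t` as an element of `L²(μ)`. -/
def expLp (μ : Measure ℝ) [IsFiniteMeasure μ] (t : ℝ) : Lp ℂ 2 μ :=
  (memLp_expFun μ t).toLp (expFun t)

/-- A family in a Hilbert space is a Parseval frame (a frame with both frame bounds equal to `1`)
if `∑ᵢ |⟨v, eᵢ⟩|² = ‖v‖²` for every `v`. -/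
def IsParsevalFrame {H ι : Type*} [NormedAddCommGroup H] [InnerProductSpace ℂ H]
    (e : ι → H) : Prop :=
  ∀ v : H, HasSum (fun i => ‖inner ℂ (e i) v‖ ^ 2) (‖v‖ ^ 2)

/-- The matrix `T = (1 / √N) (exp (2 π i R⁻¹ l b) α_l)`, `l ∈ L`, `b ∈ B`, with `N = #B`. -/
def isometryMatrix (R : ℤ) (B L : Finset ℤ) (a : ℤ → ℂ) : Matrix L B ℂ :=
  Matrix.of fun l b =>
    ((1 / Real.sqrt (B.card : ℝ) : ℝ) : ℂ) *
      (Complex.exp (2 * Real.pi * Complex.I * ((R : ℂ)⁻¹ * ((l : ℤ) : ℂ) * ((b : ℤ) : ℂ))) * a l)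

/-- The matrix `T` is an isometry: `T* T = I`. -/
def IsometryCondition (R : ℤ) (B L : Finset ℤ) (a : ℤ → ℂ) : Prop :=
  (isometryMatrix R B L a).conjTranspose * isometryMatrix R B L a = 1

/-- The set `Ω(L)` of finite words with digits in `L` that are empty or whose last digit
is nonzero. -/
def Words (L : Finset ℤ) : Set (List ℤ) :=
  {w | (∀ l ∈ w, l ∈ L) ∧ ∀ h : w ≠ [], w.getLast h ≠ 0}

/-- The frequency `l₀ + R l₁ + ⋯ + R ^ k l_k` of the word `l₀ l₁ … l_k` (`0` for the empty
word). -/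
def wordFreq (R : ℤ) : List ℤ → ℤ
  | [] => 0
  | l :: w => l + R * wordFreq R w

/-- The weight `α_{l₀} ⋯ α_{l_k}` of the word `l₀ … l_k` (`1` for the empty word). -/
def wordWeight (a : ℤ → ℂ) (w : List ℤ) : ℂ := (w.map a).prod

/-- The weighted exponential family `(∏ α_{l_i}) e_{l₀ + R l₁ + ⋯ + R ^ k l_k}` in `L²(μ)`,
indexed by the words `l₀ … l_k ∈ Ω(L)`. -/
def weightedExpFamily (R : ℤ) (L : Finset ℤ) (a : ℤ → ℂ) (μ : Measure ℝ) [IsFiniteMeasure μ]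
    (w : Words L) : Lp ℂ 2 μ :=
  wordWeight a w • expLp μ (wordFreq R w : ℝ)

/-- The arithmetic conditions: `R = 2 ^ m * r` with `m ≥ 1`, `b = 2 ^ n * q` with `n ≤ m - 1`,
`r` and `q` odd; every nonzero `l ∈ L` is `2 ^ (m - 1 - n) * s` with `s` odd and `r ∣ q * s`;
and `∑_{l ∈ L, l ≠ 0} |α_l|² = 1`. -/
def TwoDigitConditions (R b : ℤ) (L : Finset ℤ) (a : ℤ → ℂ) : Prop :=
  (∃ (m n : ℕ) (r q : ℤ), 1 ≤ m ∧ Odd r ∧ R = 2 ^ m * r ∧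
      n ≤ m - 1 ∧ Odd q ∧ b = 2 ^ n * q ∧
      ∀ l ∈ L, l ≠ 0 → ∃ s : ℤ, Odd s ∧ l = 2 ^ (m - 1 - n) * s ∧ r ∣ q * s) ∧
    ∑ l ∈ L with l ≠ 0, ‖a l‖ ^ 2 = 1

end WeightedFourier

end

noncomputable section

namespace WeightedFourier

/-! Both the isometry condition and the arithmetic conditions say that `exp (2πi l b / R) = -1` for
every nonzero digit `l`, with `∑_{l ≠ 0} |α_l|² = 1`. This common form is `HalfPeriodCondition`. The
diagonal of the Gram matrix `T*T` gives the mass, the off-diagonal entry forces the phases, and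
comparing powers of two and odd parts in `2 l b = k R` gives the arithmetic.

For the frame, let `S_l* f` be `digitAdjoint`. Self-affinity turns the coefficient of `f` at `l + R
k` into the coefficient of `S_l* f` at `k` (`coeff_add_mul`), and the isometry becomes `∑ |α_l|²
‖S_l* f‖² = ‖f‖²` (`sum_lintegral_digitAdjoint`). Induction on word length yields the Bessel bound
(`tsum_wordEnergy_le`). By density it remains to treat the exponentials.

The operator `S_l*` sends `e_t` to a multiple of `e_{(t - l)/R}`. The total energy `E(t)` of `e_t`
is therefore harmonic for a random walk `t ↦ (t - l)/R` whose probabilities are `|α_l|² |mask|²`. On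
a compact interval stable under the walk, `E` attains its minimum, and the minimizers form a closed
set invariant under all transitions of positive probability. Such a set contains `0`
(`zero_mem_of_invariant`, where the two incongruent digits enter), and `E(0) ≥ 1`. Hence `E ≥ 1`
everywhere. -/

/-- Every nonzero `l ∈ L` satisfies `2 l b = k R` with `k` odd, that is, `exp (2 π i l b / R) = -1`,
and the weights of the nonzero elements of `L` have total mass one. -/
def HalfPeriodCondition (R b : ℤ) (L : Finset ℤ) (a : ℤ → ℂ) : Prop :=
  (∀ l ∈ L, l ≠ 0 → ∃ k : ℤ, Odd k ∧ 2 * l * b = k * R) ∧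
    ∑ l ∈ L with l ≠ 0, ‖a l‖ ^ 2 = 1

/-! ### Two-adic form of the half-period condition. -/

lemma two_pow_mul_odd_inj {i j : ℕ} {x y : ℤ} (hx : Odd x) (hy : Odd y)
    (h : 2 ^ i * x = 2 ^ j * y) : i = j ∧ x = y := by
  have key : ∀ {i j : ℕ} {x y : ℤ}, Odd x → 2 ^ i * x = 2 ^ j * y → j ≤ i := by
    intro i j x y hx h
    by_contra! hij
    obtain ⟨d, rfl⟩ := Nat.exists_eq_add_of_lt hij
    have h2 : (2 : ℤ) ^ i * x = 2 ^ i * (2 * (2 ^ d * y)) := by rw [h]; ring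
    have h3 := mul_left_cancel₀ (pow_ne_zero i (two_ne_zero)) h2
    rw [h3] at hx
    exact (Int.not_odd_iff_even.2 (even_two_mul _)) hx
  have hij : i = j := le_antisymm (key hy h.symm) (key hx h)
  subst hij
  exact ⟨rfl, mul_left_cancel₀ (pow_ne_zero i (two_ne_zero)) h⟩

lemma exists_two_pow_mul_odd {x : ℤ} (hx : x ≠ 0) : ∃ (n : ℕ) (y : ℤ), Odd y ∧ x = 2 ^ n * y := by
  have hfin : FiniteMultiplicity 2 x := Int.finiteMultiplicity_iff.2 ⟨by norm_num, hx⟩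
  obtain ⟨y, hy, h⟩ := hfin.exists_eq_pow_mul_and_not_dvd
  exact ⟨_, y, by rwa [← Int.not_even_iff_odd, even_iff_two_dvd], hy⟩

/-- Unique factorization into a power of two times an odd number, applied to `2 l b = k R` with `k`
odd: the exponents give `c + n + 1 = m`, and the odd parts give `q s = r k`. Unit mass guarantees a
nonzero digit, without which `n ≤ m - 1` could not be deduced. -/
lemma twoDigitConditions_iff {R b : ℤ} (hR : R ≠ 0) (hb : b ≠ 0) {L : Finset ℤ} {a : ℤ → ℂ} :
    TwoDigitConditions R b L a ↔ HalfPeriodCondition R b L a := by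
  constructor
  · rintro ⟨⟨m, n, r, q, hm, hr, rfl, hn, hq, rfl, hl⟩, hs⟩
    refine ⟨fun l hlL hl0 => ?_, hs⟩
    obtain ⟨s, hs, rfl, k, hk⟩ := hl l hlL hl0
    refine ⟨k, Int.Odd.of_mul_right (hk ▸ hq.mul hs), ?_⟩
    obtain ⟨d, rfl⟩ : ∃ d, m = n + d + 1 := ⟨m - 1 - n, by omega⟩
    have : n + d + 1 - 1 - n = d := by omega
    rw [this]
    linear_combination (2 : ℤ) ^ (n + d + 1) * hk
  · rintro ⟨h, hs⟩
    obtain ⟨m, r, hr, hRr⟩ := exists_two_pow_mul_odd hR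
    obtain ⟨n, q, hq, hbq⟩ := exists_two_pow_mul_odd hb
    have key : ∀ l ∈ L, l ≠ 0 → ∃ (c : ℕ) (s : ℤ), Odd s ∧ l = 2 ^ c * s ∧ c + n + 1 = m ∧
        r ∣ q * s := by
      intro l hl hl0
      obtain ⟨k, hk, hlk⟩ := h l hl hl0
      obtain ⟨c, s, hs, hls⟩ := exists_two_pow_mul_odd hl0
      have h1 : (2 : ℤ) ^ (c + n + 1) * (q * s) = 2 ^ m * (r * k) := by
        rw [hls, hbq, hRr] at hlk
        linear_combination hlk
      obtain ⟨h2, h3⟩ := two_pow_mul_odd_inj (hq.mul hs) (hr.mul hk) h1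
      exact ⟨c, s, hs, hls, h2, k, h3⟩
    obtain ⟨l, hl⟩ : (L.filter (· ≠ 0)).Nonempty := by
      rw [Finset.nonempty_iff_ne_empty]
      intro h0
      rw [h0] at hs
      simp at hs
    rw [Finset.mem_filter] at hl
    obtain ⟨c, -, -, -, hc, -⟩ := key l hl.1 hl.2
    refine ⟨⟨m, n, r, q, by omega, hr, hRr, by omega, hq, hbq, fun l hl hl0 => ?_⟩, hs⟩
    obtain ⟨c, s, hs, hls, hc, hd⟩ := key l hl hl0
    obtain rfl : m - 1 - n = c := by omega
    exact ⟨s, hs, hls, hd⟩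

/-! ### The Gram matrix of `T`. -/

lemma isometryMatrix_gram_apply {R b : ℤ} (hb : b ≠ 0) {L : Finset ℤ} {a : ℤ → ℂ}
    (c d : ({0, b} : Finset ℤ)) :
    ((isometryMatrix R {0, b} L a).conjTranspose * isometryMatrix R {0, b} L a) c d =
      2⁻¹ * ∑ l ∈ L, (‖a l‖ ^ 2 : ℝ) *
        Complex.exp ((2 * Real.pi * (l * ((d : ℤ) - (c : ℤ)) / R) : ℝ) * Complex.I) := by
  rw [Matrix.mul_apply, Finset.mul_sum, ← Finset.sum_coe_sort L]
  refine Finset.sum_congr rfl fun l _ => ?_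
  have hcard : (({0, b} : Finset ℤ).card : ℝ) = 2 := by
    rw [Finset.card_pair hb.symm]; norm_num
  have h2 : ((1 / Real.sqrt 2 : ℝ) : ℂ) * ((1 / Real.sqrt 2 : ℝ) : ℂ) = 2⁻¹ := by
    rw [← Complex.ofReal_mul, div_mul_div_comm, Real.mul_self_sqrt (by norm_num)]
    norm_num
  have h3 : star (a l) * a l = ((‖a l‖ ^ 2 : ℝ) : ℂ) := by
    rw [mul_comm]; simpa using Complex.mul_conj' (a l)
  simp only [Matrix.conjTranspose_apply, isometryMatrix, Matrix.of_apply, hcard, star_mul']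
  have h4 : star (Complex.exp (2 * Real.pi * Complex.I * ((R : ℂ)⁻¹ * ((l : ℤ) : ℂ) * ((c : ℤ) : ℂ))))
      = Complex.exp (-(2 * Real.pi * Complex.I * ((R : ℂ)⁻¹ * ((l : ℤ) : ℂ) * ((c : ℤ) : ℂ)))) := by
    rw [Complex.star_def, ← Complex.exp_conj]
    congr 1
    simp only [map_mul, map_inv₀, Complex.conj_ofReal, Complex.conj_I, map_intCast, map_ofNat]
    ring
  rw [h4, Complex.star_def, Complex.conj_ofReal]
  have h5 : Complex.exp ((2 * Real.pi * ((l : ℤ) * ((d : ℤ) - (c : ℤ)) / R) : ℝ) * Complex.I)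
      = Complex.exp (-(2 * Real.pi * Complex.I * ((R : ℂ)⁻¹ * ((l : ℤ) : ℂ) * ((c : ℤ) : ℂ))))
        * Complex.exp (2 * Real.pi * Complex.I * ((R : ℂ)⁻¹ * ((l : ℤ) : ℂ) * ((d : ℤ) : ℂ))) := by
    rw [← Complex.exp_add]
    congr 1
    push_cast
    ring
  rw [h5, ← h3, ← h2, Complex.star_def]
  ring

lemma exp_two_pi_mul_eq_neg_one {x : ℝ} {k : ℤ} (hk : Odd k) (hx : 2 * x = k) :
    Complex.exp ((2 * Real.pi * x : ℝ) * Complex.I) = -1 := by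
  obtain ⟨j, rfl⟩ := hk
  have : ((2 * Real.pi * x : ℝ) : ℂ) * Complex.I
      = Real.pi * Complex.I + j * (2 * Real.pi * Complex.I) := by
    have : 2 * Real.pi * x = Real.pi + j * (2 * Real.pi) := by
      push_cast at hx
      linear_combination Real.pi * hx
    rw [this]
    push_cast
    ring
  rw [this, Complex.exp_add, Complex.exp_pi_mul_I, Complex.exp_int_mul_two_pi_mul_I, mul_one]

/-- The off-diagonal entry is half of `1` plus an average of unimodular numbers with strictly
positive weights. It vanishes only if each of these numbers is `-1`, the extreme case of the
triangle inequality. -/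
lemma isometryCondition_iff {R b : ℤ} (hR : R ≠ 0) (hb : b ≠ 0) {L : Finset ℤ}
    (hL : (0 : ℤ) ∈ L) {a : ℤ → ℂ} (ha : ∀ l ∈ L, a l ≠ 0) (ha0 : a 0 = 1) :
    IsometryCondition R {0, b} L a ↔ HalfPeriodCondition R b L a := by
  have hR' : (R : ℝ) ≠ 0 := by exact_mod_cast hR
  have hsplit : ∀ f : ℤ → ℂ, ∑ l ∈ L, f l = f 0 + ∑ l ∈ L with l ≠ 0, f l := by
    intro f
    rw [Finset.filter_ne', Finset.add_sum_erase _ _ hL]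
  constructor
  · intro h
    have h00 := congrFun (congrFun h ⟨0, by simp⟩) ⟨0, by simp⟩
    have h0b := congrFun (congrFun h ⟨0, by simp⟩) ⟨b, by simp⟩
    rw [isometryMatrix_gram_apply hb, hsplit] at h00 h0b
    rw [Matrix.one_apply_eq] at h00
    rw [Matrix.one_apply_ne (by simpa using hb.symm)] at h0b
    simp only [ha0, Int.cast_zero, sub_zero, mul_zero, zero_div, zero_mul, Complex.ofReal_zero,
      Complex.exp_zero, mul_one, norm_one, one_pow, Complex.ofReal_one] at h00 h0b
    have hs : ∑ l ∈ L with l ≠ 0, ‖a l‖ ^ 2 = 1 := by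
      have : (((∑ l ∈ L with l ≠ 0, ‖a l‖ ^ 2 : ℝ)) : ℂ) = ((1 : ℝ) : ℂ) := by
        rw [Complex.ofReal_sum]
        push_cast at h00 ⊢
        linear_combination 2 * h00
      exact_mod_cast this
    refine ⟨fun l hl hl0 => ?_, hs⟩
    -- Taking real parts produces a vanishing sum of nonnegative terms, so each cosine is `-1`.
    have hre : ∑ l ∈ L with l ≠ 0, ‖a l‖ ^ 2 * (1 + Real.cos (2 * Real.pi * (l * b / R))) = 0 := by
      have h1 : (1 : ℂ) + ∑ l ∈ L with l ≠ 0, (‖a l‖ ^ 2 : ℝ) *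
          Complex.exp ((2 * Real.pi * (l * b / R) : ℝ) * Complex.I) = 0 := by
        linear_combination 2 * h0b
      have h2 := congrArg Complex.re h1
      simp only [Complex.add_re, Complex.one_re, Complex.re_sum, Complex.re_ofReal_mul,
        Complex.exp_ofReal_mul_I_re, Complex.zero_re] at h2
      simp only [mul_add, mul_one, Finset.sum_add_distrib, hs, h2]
    have hterm := (Finset.sum_eq_zero_iff_of_nonneg (fun l _ => mul_nonneg (sq_nonneg _)
      (by linarith [Real.neg_one_le_cos (2 * Real.pi * (l * b / R))]))).1 hre l
      (Finset.mem_filter.2 ⟨hl, hl0⟩)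
    have hcos : Real.cos (2 * Real.pi * (l * b / R)) = -1 := by
      have h0 : ‖a l‖ ^ 2 ≠ 0 := pow_ne_zero _ (norm_ne_zero_iff.2 (ha l hl))
      linarith [(mul_eq_zero.1 hterm).resolve_left h0]
    obtain ⟨k, hk⟩ := Real.cos_eq_neg_one_iff.1 hcos
    refine ⟨2 * k + 1, ⟨k, rfl⟩, ?_⟩
    have h1 : (2 * l * b : ℝ) = (2 * k + 1) * R := by
      have h2 : Real.pi * (1 + 2 * k) = Real.pi * (2 * (l * b / R)) := by linear_combination hk
      have h3 := mul_left_cancel₀ Real.pi_ne_zero h2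
      field_simp at h3
      linarith
    exact_mod_cast h1
  · rintro ⟨h, hs⟩
    have hs' : ∑ l ∈ L with l ≠ 0, ((‖a l‖ ^ 2 : ℝ) : ℂ) = 1 := by
      rw [← Complex.ofReal_sum, hs, Complex.ofReal_one]
    have hdiag : ∀ c : ({0, b} : Finset ℤ),
        ((isometryMatrix R {0, b} L a).conjTranspose * isometryMatrix R {0, b} L a) c c = 1 := by
      intro c
      rw [isometryMatrix_gram_apply hb, hsplit]
      simp only [sub_self, mul_zero, zero_div, Complex.ofReal_zero, zero_mul, Complex.exp_zero,
        mul_one, hs', ha0]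
      norm_num
    have hoff : ∀ c d : ({0, b} : Finset ℤ),
        (d : ℤ) - c = b ∨ (d : ℤ) - c = -b →
        ((isometryMatrix R {0, b} L a).conjTranspose * isometryMatrix R {0, b} L a) c d = 0 := by
      intro c d hcd
      rw [isometryMatrix_gram_apply hb, hsplit]
      have : ∑ l ∈ L with l ≠ 0, ((‖a l‖ ^ 2 : ℝ) : ℂ) * Complex.exp
          ((2 * Real.pi * (l * ((d : ℤ) - (c : ℤ)) / R) : ℝ) * Complex.I) = -1 := by
        rw [← hs', ← Finset.sum_neg_distrib]
        refine Finset.sum_congr rfl fun l hl => ?_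
        rw [Finset.mem_filter] at hl
        obtain ⟨k, hk, hlk⟩ := h l hl.1 hl.2
        have hlk' : (2 * l * b : ℝ) = k * R := by exact_mod_cast hlk
        rw [mul_comm, ← neg_one_mul]
        congr 1
        rcases hcd with hcd | hcd
        · refine exp_two_pi_mul_eq_neg_one hk ?_
          have : ((d : ℤ) : ℝ) - ((c : ℤ) : ℝ) = b := by exact_mod_cast hcd
          rw [this]
          field_simp
          linarith
        · refine exp_two_pi_mul_eq_neg_one hk.neg ?_
          have : ((d : ℤ) : ℝ) - ((c : ℤ) : ℝ) = -b := by exact_mod_cast hcd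
          rw [this]
          field_simp
          push_cast
          linarith
      rw [this, ha0]
      simp
    refine Matrix.ext fun c d => ?_
    obtain ⟨c, hc⟩ := c
    obtain ⟨d, hd⟩ := d
    by_cases hcd : c = d
    · subst hcd
      rw [hdiag, Matrix.one_apply_eq]
    · rw [Matrix.one_apply_ne (by simpa using hcd)]
      apply hoff
      simp only [Finset.mem_insert, Finset.mem_singleton] at hc hd
      rcases hc with rfl | rfl <;> rcases hd with rfl | rfl <;> simp_all

/-- A power of `R` divides `b x` only if `R` divides `x`. -/
lemma exists_pow_dvd_mul_imp_dvd (R : ℤ) {b : ℤ} (hb : b ≠ 0) :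
    ∃ N : ℕ, ∀ x : ℤ, R ^ N ∣ b * x → R ∣ x := by
  induction hn : b.natAbs using Nat.strong_induction_on generalizing b with
  | _ n ih =>
    subst hn
    by_cases hco : IsCoprime R b
    · exact ⟨1, fun x hx => hco.dvd_of_dvd_mul_left (by simpa using hx)⟩
    · have hg0 : Int.gcd R b ≠ 0 := by
        rw [Ne, Int.gcd_eq_zero_iff]; exact fun h => hb h.2
      have hg1 : Int.gcd R b ≠ 1 := fun h => hco (Int.isCoprime_iff_gcd_eq_one.2 h)
      obtain ⟨u, hu⟩ := Int.gcd_dvd_left R b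
      obtain ⟨c, hc⟩ := Int.gcd_dvd_right R b
      have hc0 : c ≠ 0 := by rintro rfl; simp at hc; exact hb hc
      have hlt : c.natAbs < b.natAbs := by
        conv_rhs => rw [hc, Int.natAbs_mul, Int.natAbs_natCast]
        have : 0 < c.natAbs := Int.natAbs_pos.2 hc0
        exact lt_mul_left this (by omega)
      obtain ⟨N, hN⟩ := ih _ hlt hc0 rfl
      refine ⟨N + 1, fun x hx => hN x ?_⟩
      have hgz : ((Int.gcd R b : ℕ) : ℤ) ≠ 0 := by exact_mod_cast hg0
      -- With `g = gcd R b`, `R = g u` and `b = g c`, cancelling `g` costs one power of `R` and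
      -- replaces `b` by the smaller `c`.
      have h1 : ((Int.gcd R b : ℕ) : ℤ) * (R ^ N * u) ∣ (Int.gcd R b : ℕ) * (c * x) := by
        rw [← mul_assoc _ c, ← hc, mul_left_comm, ← hu, ← pow_succ]
        exact hx
      exact (dvd_mul_right _ _).trans (Int.dvd_of_mul_dvd_mul_left hgz h1)

/-! ### Density criterion and density of the exponentials. -/

/-- A family with Bessel bound one that satisfies the Parseval identity on a set with dense span
is a Parseval frame. -/
lemma isParsevalFrame_of_dense_span {H ι : Type*} [NormedAddCommGroup H] [InnerProductSpace ℂ H]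
    {e : ι → H} (hB : ∀ v : H, ∑' i, ‖inner ℂ (e i) v‖ₑ ^ 2 ≤ ‖v‖ₑ ^ 2) {s : Set H}
    (hs : (Submodule.span ℂ s).topologicalClosure = ⊤)
    (he : ∀ v ∈ s, ‖v‖ₑ ^ 2 ≤ ∑' i, ‖inner ℂ (e i) v‖ₑ ^ 2) : IsParsevalFrame e := by
  have hreal : ∀ v i, (‖inner ℂ (e i) v‖ₑ ^ 2).toReal = ‖inner ℂ (e i) v‖ ^ 2 := fun v i => by
    rw [ENNReal.toReal_pow, toReal_enorm]
  have hfin : ∀ v : H, ‖v‖ₑ ^ 2 ≠ ⊤ := fun v => ENNReal.pow_ne_top enorm_ne_top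
  have hfin' : ∀ v : H, ∑' i, ‖inner ℂ (e i) v‖ₑ ^ 2 ≠ ⊤ := fun v => ne_top_of_le_ne_top (hfin v) (hB v)
  have hsum : ∀ v : H, Summable fun i => ‖inner ℂ (e i) v‖ ^ 2 := fun v => by
    simpa only [hreal] using ENNReal.summable_toReal (hfin' v)
  set G : H → ℝ := fun v => ∑' i, ‖inner ℂ (e i) v‖ ^ 2 with hG
  have hGe : ∀ v, G v = (∑' i, ‖inner ℂ (e i) v‖ₑ ^ 2).toReal := fun v => by
    rw [ENNReal.tsum_toReal_eq fun i => ENNReal.pow_ne_top enorm_ne_top]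
    simp only [hreal, hG]
  have hle : ∀ v, G v ≤ ‖v‖ ^ 2 := fun v => by
    rw [hGe, ← toReal_enorm, ← ENNReal.toReal_pow]
    exact ENNReal.toReal_mono (hfin v) (hB v)
  have hG0 : ∀ v, 0 ≤ G v := fun v => tsum_nonneg fun i => sq_nonneg _
  have hpar : ∀ v w, G (v + w) + G (v - w) = 2 * G v + 2 * G w := fun v w => by
    simp only [hG]
    rw [← (hsum _).tsum_add (hsum _), ← tsum_mul_left, ← tsum_mul_left,
      ← ((hsum v).mul_left 2).tsum_add ((hsum w).mul_left 2)]
    refine tsum_congr fun i => ?_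
    rw [inner_add_right, inner_sub_right]
    have := parallelogram_law_with_norm ℂ (inner ℂ (e i) v) (inner ℂ (e i) w)
    nlinarith
  -- The defect `‖v‖² - G v` is nonnegative and obeys the parallelogram law; dropping the term at `v
  -- - w` leaves an inequality that makes its zero set closed under addition and controls it under
  -- approximation.
  have hdefect : ∀ v w, ‖v + w‖ ^ 2 - G (v + w) ≤
      2 * (‖v‖ ^ 2 - G v) + 2 * (‖w‖ ^ 2 - G w) := fun v w => by
    have := parallelogram_law_with_norm ℂ v w
    nlinarith [hle (v - w), hpar v w]
  let K : Submodule ℂ H :=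
    { carrier := {v | ‖v‖ ^ 2 ≤ G v}
      zero_mem' := by simpa using hG0 0
      add_mem' := fun {v w} hv hw => by
        simp only [Set.mem_ofPred_eq] at *
        linarith [hdefect v w]
      smul_mem' := fun c v hv => by
        simp only [Set.mem_ofPred_eq] at *
        have : G (c • v) = ‖c‖ ^ 2 * G v := by
          simp only [hG, inner_smul_right, norm_mul, mul_pow, tsum_mul_left]
        rw [this, norm_smul, mul_pow]
        exact mul_le_mul_of_nonneg_left hv (sq_nonneg _) }
  have hK : Submodule.span ℂ s ≤ K := Submodule.span_le.2 fun v hv => by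
    change ‖v‖ ^ 2 ≤ G v
    rw [hGe, ← toReal_enorm, ← ENNReal.toReal_pow]
    exact ENNReal.toReal_mono (hfin' v) (he v hv)
  intro v
  have hv : ‖v‖ ^ 2 ≤ G v := by
    have hmem : v ∈ closure (Submodule.span ℂ s : Set H) := by
      rw [← Submodule.topologicalClosure_coe, hs]
      exact Set.mem_univ v
    refine le_of_forall_pos_le_add fun ε hε => ?_
    -- The radius makes `2 ‖v - w‖² ≤ ε`, which absorbs the factor `2` in `hdefect`.
    obtain ⟨w, hw, hvw⟩ := Metric.mem_closure_iff.1 hmem (Real.sqrt (ε / 2)) (by positivity)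
    have h1 : ‖w‖ ^ 2 ≤ G w := hK hw
    have h2 := hdefect w (v - w)
    rw [add_sub_cancel] at h2
    have h3 : ‖v - w‖ ^ 2 ≤ ε / 2 := by
      rw [dist_eq_norm] at hvw
      calc ‖v - w‖ ^ 2 ≤ Real.sqrt (ε / 2) ^ 2 := by gcongr
        _ = ε / 2 := Real.sq_sqrt (by positivity)
    linarith [hG0 (v - w)]
  have := (hsum v).hasSum
  rwa [show ∑' i, ‖inner ℂ (e i) v‖ ^ 2 = ‖v‖ ^ 2 from le_antisymm (hle v) hv] at this

/-- A real integrable function whose Fourier transform vanishes is zero almost everywhere. -/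
lemma ae_eq_zero_of_fourier_eq_zero {μ : Measure ℝ} [IsFiniteMeasure μ] {u : ℝ → ℝ}
    (hu : Integrable u μ)
    (h : ∀ t : ℝ, ∫ x, Complex.exp (t * x * Complex.I) * (u x : ℂ) ∂μ = 0) : u =ᵐ[μ] 0 := by
  have hfin : ∀ {w : ℝ → ℝ}, Integrable w μ → ∫⁻ x, ENNReal.ofReal (w x) ∂μ ≠ ⊤ := fun hw =>
    hw.lintegral_lt_top.ne
  have hchar : ∀ {w : ℝ → ℝ}, Integrable w μ → ∀ t : ℝ,
      charFun (μ.withDensity fun x => ENNReal.ofReal (w x)) t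
        = ∫ x, Complex.exp (t * x * Complex.I) * ((max (w x) 0 : ℝ) : ℂ) ∂μ := by
    intro w hw t
    rw [charFun_apply_real, integral_withDensity_eq_integral_toReal_smul₀
      hw.aemeasurable.ennreal_ofReal (Filter.Eventually.of_forall fun _ => ENNReal.ofReal_lt_top)]
    refine integral_congr_ae (Filter.Eventually.of_forall fun x => ?_)
    simp only [ENNReal.toReal_ofReal', Complex.real_smul, mul_comm]
  have hint : ∀ {w : ℝ → ℝ}, Integrable w μ → ∀ t : ℝ,
      Integrable (fun x : ℝ => Complex.exp (t * x * Complex.I) * ((max (w x) 0 : ℝ) : ℂ)) μ := by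
    intro w hw t
    refine (hw.pos_part.ofReal (𝕜 := ℂ)).bdd_mul (c := 1) (by fun_prop)
      (Filter.Eventually.of_forall fun x => ?_)
    rw [← Complex.ofReal_mul, Complex.norm_exp_ofReal_mul_I]
  have h1 := isFiniteMeasure_withDensity (hfin hu)
  have h2 := isFiniteMeasure_withDensity (hfin hu.neg)
  -- The positive and negative parts of `u` are densities of finite measures with equal
  -- characteristic functions, so these measures coincide.
  have heq : (μ.withDensity fun x => ENNReal.ofReal (u x))
      = μ.withDensity fun x => ENNReal.ofReal ((-u) x) := by
    refine Measure.ext_of_charFun (funext fun t => ?_)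
    rw [hchar hu, hchar hu.neg, ← sub_eq_zero, ← integral_sub (hint hu t) (hint hu.neg t), ← h t]
    refine integral_congr_ae (Filter.Eventually.of_forall fun x => ?_)
    simp only [Pi.neg_apply]
    rw [← mul_sub, ← Complex.ofReal_sub]
    congr 2
    rcases le_total (u x) 0 with hx | hx
    · rw [max_eq_right hx, max_eq_left (by linarith)]; ring
    · rw [max_eq_left hx, max_eq_right (by linarith)]; ring
  have hae := (withDensity_eq_iff hu.aemeasurable.ennreal_ofReal
    hu.neg.aemeasurable.ennreal_ofReal (hfin hu)).1 heq
  filter_upwards [hae] with x hx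
  simp only [Pi.neg_apply] at hx
  rcases le_total (u x) 0 with h0 | h0
  · rw [ENNReal.ofReal_of_nonpos h0] at hx
    have := ENNReal.ofReal_eq_zero.1 hx.symm
    exact le_antisymm h0 (by simpa using this)
  · rw [ENNReal.ofReal_of_nonpos (show -u x ≤ 0 by linarith)] at hx
    exact le_antisymm (ENNReal.ofReal_eq_zero.1 hx) h0

lemma star_expFun (t x : ℝ) : (starRingEnd ℂ) (expFun t x) = expFun (-t) x := by
  unfold expFun
  rw [← Complex.exp_conj]
  congr 1
  simp only [map_mul, Complex.conj_ofReal, Complex.conj_I, map_ofNat]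
  push_cast
  ring

lemma expFun_eq (t x : ℝ) : expFun t x = Complex.exp ((2 * Real.pi * (t * x) : ℝ) * Complex.I) := by
  unfold expFun; congr 1; push_cast; ring

lemma norm_expFun (t x : ℝ) : ‖expFun t x‖ = 1 := by
  rw [expFun_eq, Complex.norm_exp_ofReal_mul_I]

lemma expFun_add (s t x : ℝ) : expFun (s + t) x = expFun s x * expFun t x := by
  unfold expFun
  rw [← Complex.exp_add]; congr 1; push_cast; ring

lemma expFun_add_right (t x y : ℝ) : expFun t (x + y) = expFun t x * expFun t y := by
  unfold expFun
  rw [← Complex.exp_add]; congr 1; push_cast; ring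

lemma expFun_mul_left (c t x : ℝ) : expFun (c * t) x = expFun t (c * x) := by
  unfold expFun
  congr 1; push_cast; ring

lemma expFun_int (n m : ℤ) : expFun n m = 1 := by
  unfold expFun
  rw [← Complex.exp_int_mul_two_pi_mul_I (n * m)]
  congr 1; push_cast; ring

@[fun_prop]
lemma continuous_expFun (t : ℝ) : Continuous (expFun t) := by
  unfold expFun; fun_prop

/-- The exponentials span a dense subspace of `L²(μ)`. -/
lemma span_expLp_dense (μ : Measure ℝ) [IsFiniteMeasure μ] :
    (Submodule.span ℂ (Set.range (expLp μ))).topologicalClosure = ⊤ := by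
  rw [Submodule.topologicalClosure_eq_top_iff, Submodule.eq_bot_iff]
  intro v hv
  have hv' : Integrable v μ := (Lp.memLp v).integrable (by norm_num)
  have horth : ∀ t : ℝ, ∫ x, Complex.exp (t * x * Complex.I) * v x ∂μ = 0 := by
    intro t
    -- The sign undoes the conjugation of the first argument of the inner product; `2π` undoes the
    -- normalization of `expFun`.
    have h1 := (Submodule.mem_orthogonal _ v).1 hv (expLp μ (-(t / (2 * Real.pi))))
      (Submodule.subset_span ⟨_, rfl⟩)
    rw [L2.inner_def] at h1
    rw [← h1]
    refine integral_congr_ae ?_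
    filter_upwards [(memLp_expFun μ (-(t / (2 * Real.pi)))).coeFn_toLp] with x hx
    rw [expLp, hx, RCLike.inner_apply, star_expFun, neg_neg, mul_comm (v x), expFun_eq]
    congr 3
    rw [← Complex.ofReal_mul]
    congr 1
    field_simp
  -- The conjugate of `v` also has vanishing transform, so the real and imaginary parts can be
  -- treated separately.
  have horth' : ∀ t : ℝ, ∫ x, Complex.exp (t * x * Complex.I) * (starRingEnd ℂ) (v x) ∂μ = 0 := by
    intro t
    have h1 := congrArg (starRingEnd ℂ) (horth (-t))
    rw [← integral_conj, map_zero] at h1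
    rw [← h1]
    refine integral_congr_ae (Filter.Eventually.of_forall fun x => ?_)
    simp only [map_mul, ← Complex.exp_conj, Complex.conj_ofReal, Complex.conj_I]
    congr 2
    push_cast
    ring
  have hbdd : ∀ (t : ℝ) {w : ℝ → ℂ}, Integrable w μ →
      Integrable (fun x : ℝ => Complex.exp (t * x * Complex.I) * w x) μ := by
    intro t w hw
    refine hw.bdd_mul (c := 1) (by fun_prop) (Filter.Eventually.of_forall fun x => ?_)
    rw [← Complex.ofReal_mul, Complex.norm_exp_ofReal_mul_I]
  have hvc : Integrable (fun x => (starRingEnd ℂ) (v x)) μ := by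
    simpa using (RCLike.conjCLE (K := ℂ)).toContinuousLinearMap.integrable_comp hv'
  have hre : (fun x => (v x).re) =ᵐ[μ] 0 := by
    refine ae_eq_zero_of_fourier_eq_zero hv'.re fun t => ?_
    have h1 := integral_add (hbdd t hv') (hbdd t hvc)
    rw [horth, horth', add_zero] at h1
    rw [← mul_zero (2 : ℂ)⁻¹, ← h1, ← integral_const_mul]
    refine integral_congr_ae (Filter.Eventually.of_forall fun x => ?_)
    simp only
    rw [Complex.re_eq_add_conj]
    ring
  have him : (fun x => (v x).im) =ᵐ[μ] 0 := by
    refine ae_eq_zero_of_fourier_eq_zero hv'.im fun t => ?_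
    have h1 := integral_sub (hbdd t hv') (hbdd t hvc)
    rw [horth, horth', sub_zero] at h1
    rw [← mul_zero (2 * Complex.I : ℂ)⁻¹, ← h1, ← integral_const_mul]
    refine integral_congr_ae (Filter.Eventually.of_forall fun x => ?_)
    simp only
    rw [Complex.im_eq_sub_conj]
    ring
  rw [Lp.eq_zero_iff_ae_eq_zero]
  filter_upwards [hre, him] with x h1 h2
  exact Complex.ext h1 h2

/-! ### Self-affinity as an integral identity, and the digit operators. -/

lemma IsSelfAffine.eq_smul_add {R b : ℤ} (hb : b ≠ 0) {μ : Measure ℝ}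
    (h : IsSelfAffine R {0, b} μ) :
    μ = (2 : ENNReal)⁻¹ • (μ.map (fun x : ℝ => (R : ℝ)⁻¹ * x)
      + μ.map (fun x : ℝ => (R : ℝ)⁻¹ * (x + b))) := by
  ext E hE
  rw [h E hE, Finset.card_pair hb.symm, Finset.sum_pair hb.symm, Measure.smul_apply,
    Measure.add_apply, Measure.map_apply (by fun_prop) hE, Measure.map_apply (by fun_prop) hE]
  simp

lemma IsSelfAffine.lintegral_eq {R b : ℤ} (hb : b ≠ 0) {μ : Measure ℝ}
    (h : IsSelfAffine R {0, b} μ) {F : ℝ → ENNReal} (hF : Measurable F) :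
    ∫⁻ x, F x ∂μ = ∫⁻ x, 2⁻¹ * (F ((R : ℝ)⁻¹ * x) + F ((R : ℝ)⁻¹ * (x + b))) ∂μ := by
  conv_lhs => rw [h.eq_smul_add hb]
  rw [lintegral_smul_measure, lintegral_add_measure, lintegral_map hF (by fun_prop),
    lintegral_map hF (by fun_prop), lintegral_const_mul _ (by fun_prop),
    lintegral_add_left (by fun_prop), smul_eq_mul]

lemma IsSelfAffine.integrable_comp {R b : ℤ} (hb : b ≠ 0) {μ : Measure ℝ}
    (h : IsSelfAffine R {0, b} μ) {F : ℝ → ℂ} (hF : Integrable F μ) :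
    Integrable (fun x => F ((R : ℝ)⁻¹ * x)) μ ∧
      Integrable (fun x => F ((R : ℝ)⁻¹ * (x + b))) μ := by
  rw [h.eq_smul_add hb, integrable_smul_measure (by simp) (by simp), integrable_add_measure] at hF
  exact ⟨hF.1.comp_measurable (by fun_prop), hF.2.comp_measurable (by fun_prop)⟩

lemma IsSelfAffine.integral_eq {R b : ℤ} (hb : b ≠ 0) {μ : Measure ℝ}
    (h : IsSelfAffine R {0, b} μ) {F : ℝ → ℂ} (hF : Integrable F μ) :
    ∫ x, F x ∂μ = ∫ x, 2⁻¹ * (F ((R : ℝ)⁻¹ * x) + F ((R : ℝ)⁻¹ * (x + b))) ∂μ := by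
  have h12 := h.integrable_comp hb hF
  have hF' := hF
  rw [h.eq_smul_add hb, integrable_smul_measure (by simp) (by simp), integrable_add_measure] at hF'
  conv_lhs => rw [h.eq_smul_add hb]
  rw [integral_smul_measure, integral_add_measure hF'.1 hF'.2,
    integral_map (by fun_prop) hF'.1.1, integral_map (by fun_prop) hF'.2.1, integral_const_mul,
    integral_add h12.1 h12.2]
  simp only [ENNReal.toReal_inv, ENNReal.toReal_ofNat, Complex.real_smul]
  norm_num

/-- The adjoint of the isometry `f ↦ e_l · f(R ·)` for the digit set `{0, b}`. -/
def digitAdjoint (R b l : ℤ) (f : ℝ → ℂ) (y : ℝ) : ℂ :=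
  2⁻¹ * (expFun (-l) ((R : ℝ)⁻¹ * y) * f ((R : ℝ)⁻¹ * y) +
    expFun (-l) ((R : ℝ)⁻¹ * (y + b)) * f ((R : ℝ)⁻¹ * (y + b)))

/-- The Fourier coefficient of `f` at the frequency `t` with respect to `μ`. -/
def coeff (μ : Measure ℝ) (t : ℝ) (f : ℝ → ℂ) : ℂ := ∫ x, expFun (-t) x * f x ∂μ

lemma measurable_digitAdjoint (R b l : ℤ) {f : ℝ → ℂ} (hf : Measurable f) :
    Measurable (digitAdjoint R b l f) := by
  have := (continuous_expFun (-l)).measurable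
  unfold digitAdjoint
  fun_prop

lemma integrable_expFun_mul {μ : Measure ℝ} {f : ℝ → ℂ} (hf : Integrable f μ) (t : ℝ) :
    Integrable (fun x => expFun t x * f x) μ :=
  hf.bdd_mul (c := 1) (by fun_prop) (Filter.Eventually.of_forall fun x => (norm_expFun t x).le)

lemma integrable_digitAdjoint {R b : ℤ} (hb : b ≠ 0) {μ : Measure ℝ}
    (h : IsSelfAffine R {0, b} μ) (l : ℤ) {f : ℝ → ℂ} (hf : Integrable f μ) :
    Integrable (digitAdjoint R b l f) μ := by
  have := h.integrable_comp hb (integrable_expFun_mul hf (-l))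
  exact (this.1.add this.2).const_mul _

/-- After substituting `(x + c)/R`, the factor `e_{-Rk}` becomes `e_{-k}(x + c)`. Since `k c` is an
integer, this equals `e_{-k}(x)` on both branches and factors out. -/
lemma coeff_add_mul {R b : ℤ} (hR : R ≠ 0) (hb : b ≠ 0) {μ : Measure ℝ}
    (h : IsSelfAffine R {0, b} μ) {f : ℝ → ℂ} (hf : Integrable f μ) (l k : ℤ) :
    coeff μ ((l + R * k : ℤ) : ℝ) f = coeff μ k (digitAdjoint R b l f) := by
  have hR' : (R : ℝ) ≠ 0 := by exact_mod_cast hR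
  unfold coeff
  rw [h.integral_eq hb (integrable_expFun_mul hf _)]
  refine integral_congr_ae (Filter.Eventually.of_forall fun x => ?_)
  have key : ∀ y : ℝ, expFun (-((l + R * k : ℤ) : ℝ)) ((R : ℝ)⁻¹ * y)
      = expFun (-l) ((R : ℝ)⁻¹ * y) * expFun (-k) y := fun y => by
    have : -((l + R * k : ℤ) : ℝ) = -l + R * -k := by push_cast; ring
    rw [this, expFun_add, expFun_mul_left, mul_inv_cancel_left₀ hR']
  have hk : expFun (-k) b = 1 := by exact_mod_cast expFun_int (-k) b
  simp only [digitAdjoint]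
  rw [key, key, expFun_add_right _ x, hk]
  ring

/-- The trigonometric polynomial `(1 + e_t(b)) / 2` of the digit set `{0, b}`. -/
def mask (b : ℤ) (t : ℝ) : ℂ := 2⁻¹ * (1 + expFun t b)

lemma digitAdjoint_expFun (R b l : ℤ) (t : ℝ) :
    digitAdjoint R b l (expFun t) =
      fun y => mask b ((R : ℝ)⁻¹ * (t - l)) * expFun ((R : ℝ)⁻¹ * (t - l)) y := by
  funext y
  unfold digitAdjoint mask
  rw [← expFun_add, ← expFun_add, ← expFun_mul_left, ← expFun_mul_left, expFun_add_right]
  have : (R : ℝ)⁻¹ * (-l + t) = (R : ℝ)⁻¹ * (t - l) := by ring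
  rw [this]
  ring

lemma enorm_sq_add_enorm_sq_sub (z w : ℂ) :
    ‖z + w‖ₑ ^ 2 + ‖z - w‖ₑ ^ 2 = 2 * (‖z‖ₑ ^ 2 + ‖w‖ₑ ^ 2) := by
  have := parallelogram_law_with_norm ℂ z w
  have h : ∀ z : ℂ, ‖z‖ₑ ^ 2 = ENNReal.ofReal (‖z‖ ^ 2) := fun z => by
    rw [← ofReal_norm, ENNReal.ofReal_pow (norm_nonneg _)]
  rw [h, h, h, h, ← ENNReal.ofReal_add (by positivity) (by positivity),
    ← ENNReal.ofReal_add (by positivity) (by positivity), ← ENNReal.ofReal_ofNat,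
    ← ENNReal.ofReal_mul (by norm_num)]
  congr 1

lemma sum_enorm_sq_eq_one {L : Finset ℤ} {a : ℤ → ℂ}
    (hs : ∑ l ∈ L with l ≠ 0, ‖a l‖ ^ 2 = 1) : ∑ l ∈ L with l ≠ 0, ‖a l‖ₑ ^ 2 = 1 := by
  have h : ∀ z : ℂ, ‖z‖ₑ ^ 2 = ENNReal.ofReal (‖z‖ ^ 2) := fun z => by
    rw [← ofReal_norm, ENNReal.ofReal_pow (norm_nonneg _)]
  simp only [h]
  rw [← ENNReal.ofReal_sum_of_nonneg (fun _ _ => sq_nonneg _), hs, ENNReal.ofReal_one]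

lemma expFun_half_period {R b l k : ℤ} (hR : R ≠ 0) (hk : Odd k) (h : 2 * l * b = k * R) :
    expFun (-l) ((R : ℝ)⁻¹ * b) = -1 := by
  have hR' : (R : ℝ) ≠ 0 := by exact_mod_cast hR
  have h' : (2 * l * b : ℝ) = k * R := by exact_mod_cast h
  rw [expFun_eq]
  refine exp_two_pi_mul_eq_neg_one hk.neg ?_
  field_simp
  push_cast
  linarith

/-- Pointwise form of the isometry. With branch values `z` and `w`, digit `0` contributes `(z +
w)/2`, and each nonzero digit contributes `(z - w)/2` up to a unimodular factor because of the half
period. The nonzero weights add up to one, so the parallelogram law concludes. -/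
lemma sum_enorm_sq_digitAdjoint {R b : ℤ} (hR : R ≠ 0) {L : Finset ℤ} (hL : (0 : ℤ) ∈ L)
    {a : ℤ → ℂ} (ha0 : a 0 = 1) (h : HalfPeriodCondition R b L a) (f : ℝ → ℂ) (y : ℝ) :
    ∑ l ∈ L, ‖a l‖ₑ ^ 2 * ‖digitAdjoint R b l f y‖ₑ ^ 2 =
      2⁻¹ * (‖f ((R : ℝ)⁻¹ * y)‖ₑ ^ 2 + ‖f ((R : ℝ)⁻¹ * (y + b))‖ₑ ^ 2) := by
  set z := f ((R : ℝ)⁻¹ * y)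
  set w := f ((R : ℝ)⁻¹ * (y + b))
  have hunit : ∀ t x : ℝ, ‖expFun t x‖ₑ = 1 := fun t x => by
    rw [← ofReal_norm, norm_expFun, ENNReal.ofReal_one]
  have h0 : ‖digitAdjoint R b 0 f y‖ₑ ^ 2 = ‖(2⁻¹ : ℂ)‖ₑ ^ 2 * ‖z + w‖ₑ ^ 2 := by
    rw [← mul_pow, ← enorm_mul]
    simp [digitAdjoint, z, w, expFun]
  have h1 : ∀ l ∈ L.filter (· ≠ 0), ‖a l‖ₑ ^ 2 * ‖digitAdjoint R b l f y‖ₑ ^ 2 =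
      ‖a l‖ₑ ^ 2 * (‖(2⁻¹ : ℂ)‖ₑ ^ 2 * ‖z - w‖ₑ ^ 2) := by
    intro l hl
    rw [Finset.mem_filter] at hl
    obtain ⟨k, hk, hlk⟩ := h.1 l hl.1 hl.2
    have : digitAdjoint R b l f y = expFun (-l) ((R : ℝ)⁻¹ * y) * (2⁻¹ * (z - w)) := by
      unfold digitAdjoint
      rw [mul_add (R : ℝ)⁻¹ y, expFun_add_right, expFun_half_period hR hk hlk, ← mul_add]
      ring
    rw [this, enorm_mul, hunit, one_mul, enorm_mul, mul_pow ‖(2⁻¹ : ℂ)‖ₑ]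
  rw [← Finset.add_sum_erase _ _ hL, ← Finset.filter_ne', Finset.sum_congr rfl h1,
    ← Finset.sum_mul, sum_enorm_sq_eq_one h.2, ha0, h0, enorm_one, one_pow, one_mul, one_mul,
    ← mul_add, enorm_sq_add_enorm_sq_sub, ← mul_assoc]
  congr 1
  have : ‖(2⁻¹ : ℂ)‖ₑ = 2⁻¹ := by
    rw [enorm_inv two_ne_zero]
    congr 1
    rw [← ofReal_norm, Complex.norm_ofNat, ENNReal.ofReal_ofNat]
  rw [this, sq, mul_assoc, ENNReal.inv_mul_cancel two_ne_zero ENNReal.ofNat_ne_top, mul_one]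

lemma sum_lintegral_digitAdjoint {R b : ℤ} (hR : R ≠ 0) (hb : b ≠ 0) {L : Finset ℤ}
    (hL : (0 : ℤ) ∈ L) {a : ℤ → ℂ} (ha0 : a 0 = 1) (h : HalfPeriodCondition R b L a)
    {μ : Measure ℝ} (hμ : IsSelfAffine R {0, b} μ) {f : ℝ → ℂ} (hf : Measurable f) :
    ∑ l ∈ L, ‖a l‖ₑ ^ 2 * ∫⁻ x, ‖digitAdjoint R b l f x‖ₑ ^ 2 ∂μ = ∫⁻ x, ‖f x‖ₑ ^ 2 ∂μ := by
  rw [hμ.lintegral_eq hb (hf.enorm.pow_const 2)]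
  simp_rw [← sum_enorm_sq_digitAdjoint hR hL ha0 h f]
  have hm := fun l => (measurable_digitAdjoint R b l hf).enorm.pow_const 2
  rw [lintegral_finsetSum _ fun l _ => (hm l).const_mul _]
  exact Finset.sum_congr rfl fun l _ => (lintegral_const_mul _ (hm l)).symm

/-! ### Words and their first digits. -/

/-- Prepend a digit to a word, where the digit `0` leaves the empty word unchanged. -/
def consWord {L : Finset ℤ} (p : L × Words L) : Words L :=
  if h : (p.1 : ℤ) = 0 ∧ (p.2 : List ℤ) = [] then p.2 else
    ⟨(p.1 : ℤ) :: p.2, fun l hl => by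
        rcases List.mem_cons.1 hl with rfl | hl
        · exact p.1.2
        · exact p.2.2.1 l hl, fun _ => by
        by_cases hw : (p.2 : List ℤ) = []
        · simpa [hw] using h
        · rw [List.getLast_cons hw]
          exact p.2.2.2 hw⟩

lemma coe_consWord {L : Finset ℤ} (p : L × Words L) :
    (consWord p : List ℤ) =
      if (p.1 : ℤ) = 0 ∧ (p.2 : List ℤ) = [] then [] else (p.1 : ℤ) :: p.2 := by
  unfold consWord
  split_ifs with h
  · exact h.2
  · rfl

/-- Prepending `0` to the empty word would end in a zero digit. Sending that pair to the empty word
itself accounts for the one word without a first digit. -/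
lemma consWord_bijective {L : Finset ℤ} (hL : (0 : ℤ) ∈ L) :
    Function.Bijective (consWord (L := L)) := by
  constructor
  · rintro ⟨⟨l, hl⟩, ⟨w, hw⟩⟩ ⟨⟨m, hm⟩, ⟨v, hv⟩⟩ h
    have h' := congrArg (Subtype.val) h
    rw [coe_consWord, coe_consWord] at h'
    simp only at h'
    split_ifs at h' with h1 h2 h2
    · obtain ⟨rfl, rfl⟩ := h1
      obtain ⟨rfl, rfl⟩ := h2
      rfl
    · obtain ⟨rfl, rfl⟩ := List.cons.inj h'
      rfl
  · rintro ⟨w, hw⟩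
    cases w with
    | nil => exact ⟨(⟨0, hL⟩, ⟨[], hw⟩), Subtype.ext (by simp [coe_consWord])⟩
    | cons l w =>
      have hw' : w ∈ Words L := by
        refine ⟨fun m hm => hw.1 m (List.mem_cons_of_mem _ hm), fun hne => ?_⟩
        rw [← List.getLast_cons hne]
        exact hw.2 _
      refine ⟨(⟨l, hw.1 l List.mem_cons_self⟩, ⟨w, hw'⟩), Subtype.ext ?_⟩
      rw [coe_consWord, if_neg]
      rintro ⟨rfl, rfl⟩
      exact hw.2 (by simp) (by simp)

lemma tsum_words {L : Finset ℤ} (hL : (0 : ℤ) ∈ L) (F : Words L → ENNReal) :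
    ∑' w, F w = ∑ l : L, ∑' w, F (consWord (l, w)) := by
  rw [← (Equiv.ofBijective _ (consWord_bijective hL)).tsum_eq, ENNReal.tsum_prod', tsum_fintype]
  rfl

lemma length_consWord_le_succ {L : Finset ℤ} (p : L × Words L) (n : ℕ) :
    (consWord p : List ℤ).length ≤ n + 1 ↔ (p.2 : List ℤ).length ≤ n := by
  rw [coe_consWord]
  split_ifs with h
  · simp [h.2]
  · simp

lemma wordFreq_consWord (R : ℤ) {L : Finset ℤ} (p : L × Words L) :
    wordFreq R (consWord p) = p.1 + R * wordFreq R p.2 := by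
  rw [coe_consWord]
  split_ifs with h
  · simp [h.1, h.2, wordFreq]
  · rfl

lemma wordWeight_consWord {a : ℤ → ℂ} (ha0 : a 0 = 1) {L : Finset ℤ} (p : L × Words L) :
    wordWeight a (consWord p) = a p.1 * wordWeight a p.2 := by
  rw [coe_consWord]
  split_ifs with h
  · simp [h.1, h.2, wordWeight, ha0]
  · simp [wordWeight]

/-! ### Energy of a function and the Bessel bound. -/

/-- The squared modulus of the coefficient of `f` against the member of the weighted family
indexed by `w`. -/
def wordEnergy (R : ℤ) (L : Finset ℤ) (a : ℤ → ℂ) (μ : Measure ℝ) (f : ℝ → ℂ) (w : Words L) :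
    ENNReal :=
  ‖wordWeight a w‖ₑ ^ 2 * ‖coeff μ (wordFreq R w) f‖ₑ ^ 2

lemma wordEnergy_consWord {R b : ℤ} (hR : R ≠ 0) (hb : b ≠ 0) {L : Finset ℤ}
    {a : ℤ → ℂ} (ha0 : a 0 = 1) {μ : Measure ℝ} (hμ : IsSelfAffine R {0, b} μ) {f : ℝ → ℂ}
    (hf : Integrable f μ) (p : L × Words L) :
    wordEnergy R L a μ f (consWord p) =
      ‖a p.1‖ₑ ^ 2 * wordEnergy R L a μ (digitAdjoint R b p.1 f) p.2 := by
  unfold wordEnergy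
  rw [wordFreq_consWord, wordWeight_consWord ha0, coeff_add_mul hR hb hμ hf, enorm_mul, mul_pow,
    mul_assoc]

lemma tsum_wordEnergy_eq {R b : ℤ} (hR : R ≠ 0) (hb : b ≠ 0) {L : Finset ℤ}
    (hL : (0 : ℤ) ∈ L) {a : ℤ → ℂ} (ha0 : a 0 = 1) {μ : Measure ℝ}
    (hμ : IsSelfAffine R {0, b} μ) {f : ℝ → ℂ} (hf : Integrable f μ) :
    ∑' w, wordEnergy R L a μ f w =
      ∑ l ∈ L, ‖a l‖ₑ ^ 2 * ∑' w, wordEnergy R L a μ (digitAdjoint R b l f) w := by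
  rw [tsum_words hL, ← Finset.sum_coe_sort L]
  refine Finset.sum_congr rfl fun l _ => ?_
  simp_rw [wordEnergy_consWord hR hb ha0 hμ hf]
  rw [ENNReal.tsum_mul_left]

lemma enorm_integral_sq_le {μ : Measure ℝ} [IsProbabilityMeasure μ] {f : ℝ → ℂ}
    (hf : Measurable f) : ‖∫ x, f x ∂μ‖ₑ ^ 2 ≤ ∫⁻ x, ‖f x‖ₑ ^ 2 ∂μ := by
  have h1 : ‖∫ x, f x ∂μ‖ₑ ≤ (∫⁻ x, ‖f x‖ₑ ^ 2 ∂μ) ^ (1 / 2 : ℝ) := by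
    refine (enorm_integral_le_lintegral_enorm f).trans ?_
    have := eLpNorm_le_eLpNorm_of_exponent_le (p := 1) (q := 2) (μ := μ) (by norm_num)
      hf.aestronglyMeasurable
    rw [eLpNorm_one_eq_lintegral_enorm, eLpNorm_eq_lintegral_rpow_enorm_toReal (by norm_num)
      (by norm_num)] at this
    simpa using this
  calc ‖∫ x, f x ∂μ‖ₑ ^ 2 ≤ ((∫⁻ x, ‖f x‖ₑ ^ 2 ∂μ) ^ (1 / 2 : ℝ)) ^ 2 := by gcongr
    _ = ∫⁻ x, ‖f x‖ₑ ^ 2 ∂μ := by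
      rw [← ENNReal.rpow_natCast, ← ENNReal.rpow_mul]; norm_num

/-- Stripping the first digit lowers the length bound and replaces `f` by its digit adjoints, whose
weighted norms add up to that of `f`. The base case is `|∫ f|² ≤ ∫ |f|²`, the contribution of the
empty word. -/
lemma tsum_wordEnergy_le_of_length {R b : ℤ} (hR : R ≠ 0) (hb : b ≠ 0) {L : Finset ℤ}
    (hL : (0 : ℤ) ∈ L) {a : ℤ → ℂ} (ha0 : a 0 = 1) (h : HalfPeriodCondition R b L a)
    {μ : Measure ℝ} [IsProbabilityMeasure μ] (hμ : IsSelfAffine R {0, b} μ) (n : ℕ) {f : ℝ → ℂ}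
    (hf : Measurable f) (hfi : Integrable f μ) :
    ∑' w : Words L, (if (w : List ℤ).length ≤ n then wordEnergy R L a μ f w else 0) ≤
      ∫⁻ x, ‖f x‖ₑ ^ 2 ∂μ := by
  induction n generalizing f with
  | zero =>
    have hnil : ([] : List ℤ) ∈ Words L := ⟨by simp, by simp⟩
    rw [tsum_eq_single ⟨[], hnil⟩]
    · simpa [wordEnergy, wordWeight, wordFreq, coeff, expFun] using enorm_integral_sq_le hf
    · rintro ⟨w, hw⟩ hne
      rw [if_neg]
      intro h0
      exact hne (Subtype.ext (List.length_eq_zero_iff.1 (Nat.le_zero.1 h0)))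
  | succ n ih =>
    rw [tsum_words hL, ← sum_lintegral_digitAdjoint hR hb hL ha0 h hμ hf, ← Finset.sum_coe_sort L]
    refine Finset.sum_le_sum fun l _ => ?_
    simp_rw [length_consWord_le_succ, wordEnergy_consWord hR hb ha0 hμ hfi, ← mul_ite_zero]
    rw [ENNReal.tsum_mul_left]
    gcongr
    exact ih (measurable_digitAdjoint R b l hf) (integrable_digitAdjoint hb hμ l hfi)

lemma tsum_wordEnergy_le {R b : ℤ} (hR : R ≠ 0) (hb : b ≠ 0) {L : Finset ℤ}
    (hL : (0 : ℤ) ∈ L) {a : ℤ → ℂ} (ha0 : a 0 = 1) (h : HalfPeriodCondition R b L a)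
    {μ : Measure ℝ} [IsProbabilityMeasure μ] (hμ : IsSelfAffine R {0, b} μ) {f : ℝ → ℂ}
    (hf : Measurable f) (hfi : Integrable f μ) :
    ∑' w, wordEnergy R L a μ f w ≤ ∫⁻ x, ‖f x‖ₑ ^ 2 ∂μ := by
  rw [ENNReal.tsum_eq_iSup_sum]
  refine iSup_le fun s => ?_
  set n := s.sup fun w => (w : List ℤ).length
  calc ∑ w ∈ s, wordEnergy R L a μ f w
      = ∑ w ∈ s, (if (w : List ℤ).length ≤ n then wordEnergy R L a μ f w else 0) :=
        Finset.sum_congr rfl fun w hw => by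
          rw [if_pos (Finset.le_sup (f := fun w : Words L => (w : List ℤ).length) hw)]
    _ ≤ _ := ENNReal.sum_le_tsum s
    _ ≤ _ := tsum_wordEnergy_le_of_length hR hb hL ha0 h hμ n hf hfi

/-! ### The random walk on frequencies. -/

/-- The total energy of the exponential `e_t` against the weighted family. -/
def expEnergy (R : ℤ) (L : Finset ℤ) (a : ℤ → ℂ) (μ : Measure ℝ) (t : ℝ) : ENNReal :=
  ∑' w, wordEnergy R L a μ (expFun t) w

lemma coeff_expFun (μ : Measure ℝ) (s t : ℝ) :
    coeff μ s (expFun t) = charFun μ (2 * Real.pi * (t - s)) := by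
  rw [charFun_apply_real]
  refine integral_congr_ae (Filter.Eventually.of_forall fun x => ?_)
  simp only
  rw [← expFun_add, expFun_eq]
  congr 1
  push_cast
  ring

lemma lowerSemicontinuous_expEnergy (R : ℤ) (L : Finset ℤ) (a : ℤ → ℂ) (μ : Measure ℝ)
    [IsFiniteMeasure μ] : LowerSemicontinuous (expEnergy R L a μ) := by
  refine lowerSemicontinuous_tsum fun w => Continuous.lowerSemicontinuous ?_
  unfold wordEnergy
  simp_rw [coeff_expFun]
  have h1 : Continuous fun t : ℝ => charFun μ (2 * Real.pi * (t - wordFreq R w)) :=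
    continuous_charFun.comp (by fun_prop)
  exact (ENNReal.continuous_const_mul (ENNReal.pow_ne_top enorm_ne_top)).comp
    ((ENNReal.continuous_pow 2).comp h1.enorm)

lemma integrable_expFun (μ : Measure ℝ) [IsFiniteMeasure μ] (t : ℝ) : Integrable (expFun t) μ :=
  (memLp_expFun μ t).integrable (by norm_num)

lemma lintegral_enorm_expFun (μ : Measure ℝ) [IsProbabilityMeasure μ] (t : ℝ) :
    ∫⁻ x, ‖expFun t x‖ₑ ^ 2 ∂μ = 1 := by
  have (x : ℝ) : ‖expFun t x‖ₑ = 1 := by rw [← ofReal_norm, norm_expFun, ENNReal.ofReal_one]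
  simp [this]

lemma one_le_expEnergy_zero (R : ℤ) (L : Finset ℤ) (a : ℤ → ℂ) (μ : Measure ℝ)
    [IsProbabilityMeasure μ] : 1 ≤ expEnergy R L a μ 0 := by
  have hnil : ([] : List ℤ) ∈ Words L := ⟨by simp, by simp⟩
  refine le_trans (le_of_eq ?_) (ENNReal.le_tsum ⟨[], hnil⟩)
  simp [wordEnergy, wordWeight, wordFreq, coeff_expFun]

/-- Harmonicity of the energy: the first-digit recursion stays within exponentials because each
digit adjoint maps `e_t` to a multiple of another exponential. -/
lemma expEnergy_eq {R b : ℤ} (hR : R ≠ 0) (hb : b ≠ 0) {L : Finset ℤ}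
    (hL : (0 : ℤ) ∈ L) {a : ℤ → ℂ} (ha0 : a 0 = 1) {μ : Measure ℝ} [IsFiniteMeasure μ]
    (hμ : IsSelfAffine R {0, b} μ) (t : ℝ) :
    expEnergy R L a μ t = ∑ l ∈ L, (‖a l‖ₑ ^ 2 * ‖mask b ((R : ℝ)⁻¹ * (t - l))‖ₑ ^ 2) *
      expEnergy R L a μ ((R : ℝ)⁻¹ * (t - l)) := by
  unfold expEnergy
  rw [tsum_wordEnergy_eq hR hb hL ha0 hμ (integrable_expFun μ t)]
  refine Finset.sum_congr rfl fun l _ => ?_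
  rw [mul_assoc, ← ENNReal.tsum_mul_left (a := ‖mask b _‖ₑ ^ 2)]
  congr 2
  funext w
  unfold wordEnergy coeff
  rw [digitAdjoint_expFun, mul_left_comm, ← mul_pow ‖mask b _‖ₑ, ← enorm_mul,
    ← integral_const_mul]
  simp only [mul_left_comm]

/-- The energy identity applied to the unit vector `e_t`; it says that the transition weights are
probabilities. -/
lemma sum_enorm_sq_mask {R b : ℤ} (hR : R ≠ 0) (hb : b ≠ 0) {L : Finset ℤ}
    (hL : (0 : ℤ) ∈ L) {a : ℤ → ℂ} (ha0 : a 0 = 1) (h : HalfPeriodCondition R b L a)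
    {μ : Measure ℝ} [IsProbabilityMeasure μ] (hμ : IsSelfAffine R {0, b} μ) (t : ℝ) :
    ∑ l ∈ L, ‖a l‖ₑ ^ 2 * ‖mask b ((R : ℝ)⁻¹ * (t - l))‖ₑ ^ 2 = 1 := by
  rw [← lintegral_enorm_expFun μ t, ← sum_lintegral_digitAdjoint hR hb hL ha0 h hμ
    (continuous_expFun t).measurable]
  refine Finset.sum_congr rfl fun l _ => ?_
  have hm := ((continuous_expFun ((R : ℝ)⁻¹ * (t - l))).measurable).enorm.pow_const 2
  simp_rw [digitAdjoint_expFun, enorm_mul, mul_pow]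
  rw [lintegral_const_mul _ hm, lintegral_enorm_expFun, mul_one]

lemma mask_eq_zero {b : ℤ} {t : ℝ} (h : mask b t = 0) : ∃ k : ℤ, 2 * (t * b) = 2 * k + 1 := by
  have h1 : expFun t b = -1 := by
    have := (mul_eq_zero.1 h).resolve_left (by norm_num)
    linear_combination this
  have h2 : Real.cos (2 * Real.pi * (t * b)) = -1 := by
    rw [expFun_eq] at h1
    simpa only [Complex.exp_ofReal_mul_I_re, Complex.neg_re, Complex.one_re] using
      congrArg Complex.re h1
  obtain ⟨k, hk⟩ := Real.cos_eq_neg_one_iff.1 h2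
  refine ⟨k, mul_left_cancel₀ Real.pi_ne_zero ?_⟩
  linear_combination -hk

/-- A nonempty closed set which is invariant under all transitions of positive weight contains
the origin. -/
lemma zero_mem_of_invariant {R b : ℤ} (hR : 2 ≤ |R|) (hR2 : Even R) (hb : b ≠ 0) {L : Finset ℤ}
    (hL : (0 : ℤ) ∈ L) (h : ∀ l ∈ L, l ≠ 0 → ∃ k : ℤ, Odd k ∧ 2 * l * b = k * R)
    (hL2 : ∃ l₁ ∈ L, ∃ l₂ ∈ L, l₁ ≠ 0 ∧ l₂ ≠ 0 ∧ ¬ l₁ ≡ l₂ [ZMOD R])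
    {M : Set ℝ} (hM : IsClosed M) (hne : M.Nonempty)
    (hinv : ∀ t ∈ M, ∀ l ∈ L, mask b ((R : ℝ)⁻¹ * (t - l)) ≠ 0 → (R : ℝ)⁻¹ * (t - l) ∈ M) :
    (0 : ℝ) ∈ M := by
  have hR0 : R ≠ 0 := by rintro rfl; norm_num at hR
  have hR' : (R : ℝ) ≠ 0 := by exact_mod_cast hR0
  by_contra h0
  have hstep0 : ∀ t ∈ M, mask b ((R : ℝ)⁻¹ * t) ≠ 0 → (R : ℝ)⁻¹ * t ∈ M := fun t ht hm => by
    simpa using hinv t ht 0 hL (by simpa using hm)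
  -- Following digit `0` forever would converge to `0`, which closedness would put in `M`; so the
  -- path must meet a zero of the mask.
  have hstuck : ∀ t ∈ M, ∃ n : ℕ, ((R : ℝ)⁻¹) ^ n * t ∈ M ∧
      mask b ((R : ℝ)⁻¹ * (((R : ℝ)⁻¹) ^ n * t)) = 0 := by
    intro t ht
    by_contra! hcon
    have hall : ∀ n : ℕ, ((R : ℝ)⁻¹) ^ n * t ∈ M := by
      intro n
      induction n with
      | zero => simpa using ht
      | succ n ih =>
        rw [pow_succ', mul_assoc]
        exact hstep0 _ ih (hcon n ih)
    have hlim : Filter.Tendsto (fun n : ℕ => ((R : ℝ)⁻¹) ^ n * t) Filter.atTop (nhds 0) := by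
      simpa using (tendsto_pow_atTop_nhds_zero_of_abs_lt_one (abs_inv_lt_one hR)).mul_const t
    exact h0 (hM.mem_of_tendsto hlim (Filter.Eventually.of_forall hall))
  -- A mask zero gives `b t = R^(n+1) (2k + 1)/2`, an integer because `R` is even.
  have hint : ∀ t ∈ M, ∃ z : ℤ, b * t = z := by
    intro t ht
    obtain ⟨n, -, hn⟩ := hstuck t ht
    obtain ⟨k, hk⟩ := mask_eq_zero hn
    obtain ⟨r, hr⟩ := hR2
    refine ⟨R ^ n * r * (2 * k + 1), ?_⟩
    have hr' : (R : ℝ) = r + r := by exact_mod_cast hr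
    have h1 : b * t = (R : ℝ) ^ n * R * ((R : ℝ)⁻¹ * (((R : ℝ)⁻¹) ^ n * t) * b) := by
      rw [inv_pow]
      field_simp
    have h2 : (R : ℝ)⁻¹ * (((R : ℝ)⁻¹) ^ n * t) * b = (2 * k + 1) / 2 := by linarith
    rw [h1, h2]
    push_cast
    rw [show (R : ℝ) ^ n * R = R ^ n * (r + r) by rw [← hr']]
    ring
  -- Where digit `0` is blocked, a nonzero digit shifts the phase by another half period, so the
  -- mask becomes `1` and every nonzero digit is allowed.
  have hbranch : ∀ t ∈ M, mask b ((R : ℝ)⁻¹ * t) = 0 → ∀ l ∈ L, l ≠ 0 →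
      (R : ℝ)⁻¹ * (t - l) ∈ M := by
    intro t ht hm l hl hl0
    refine hinv t ht l hl ?_
    obtain ⟨k, hk, hlk⟩ := h l hl hl0
    have h1 : expFun ((R : ℝ)⁻¹ * t) b = -1 := by
      have := (mul_eq_zero.1 hm).resolve_left (by norm_num)
      linear_combination this
    have h2 : expFun ((R : ℝ)⁻¹ * (t - l)) b = 1 := by
      have : (R : ℝ)⁻¹ * (t - l) = (R : ℝ)⁻¹ * t + (R : ℝ)⁻¹ * -l := by ring
      rw [this, expFun_add, h1, expFun_mul_left _ (-(l : ℝ)), expFun_half_period hR0 hk hlk]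
      norm_num
    rw [mask, h2]
    norm_num
  obtain ⟨l₁, hl₁, l₂, hl₂, hl₁0, hl₂0, hmod⟩ := hL2
  have hpred : ∀ t ∈ M, ∃ (k : ℤ), ∃ t' ∈ M, t = k + R * t' := by
    intro t ht
    by_cases hm : mask b ((R : ℝ)⁻¹ * t) = 0
    · exact ⟨l₁, _, hbranch t ht hm l₁ hl₁ hl₁0, by field_simp; ring⟩
    · exact ⟨0, _, hstep0 t ht hm, by field_simp; simp⟩
  have hpow : ∀ n : ℕ, ∀ t ∈ M, ∃ (k : ℤ), ∃ t' ∈ M, t = k + R ^ n * t' := by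
    intro n
    induction n with
    | zero => exact fun t ht => ⟨0, t, ht, by simp⟩
    | succ n ih =>
      intro t ht
      obtain ⟨k, t', ht', rfl⟩ := ih t ht
      obtain ⟨k', t'', ht'', rfl⟩ := hpred t' ht'
      exact ⟨k + R ^ n * k', t'', ht'', by push_cast; ring⟩
  obtain ⟨t, ht⟩ := hne
  obtain ⟨n, hn, hm⟩ := hstuck t ht
  obtain ⟨N, hN⟩ := exists_pow_dvd_mul_imp_dvd R hb
  -- Both `l₁` and `l₂` are followed from the same blocked point and then `N` further steps are
  -- taken. Subtracting the two identities eliminates that point, and the choice of `N` cancels `b`,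
  -- giving `l₁ ≡ l₂` modulo `R`.
  have hdig : ∀ l ∈ L, l ≠ 0 → ∃ k z : ℤ,
      b * (((R : ℝ)⁻¹) ^ n * t - l) = R * (b * k + R ^ N * z) := by
    intro l hl hl0
    obtain ⟨k, t', ht', hk⟩ := hpow N _ (hbranch _ hn hm l hl hl0)
    obtain ⟨z, hz⟩ := hint t' ht'
    refine ⟨k, z, ?_⟩
    rw [← hz]
    have : ((R : ℝ)⁻¹) ^ n * t - l = R * ((R : ℝ)⁻¹ * (((R : ℝ)⁻¹) ^ n * t - l)) := by
      rw [mul_inv_cancel_left₀ hR']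
    rw [this, hk]
    ring
  obtain ⟨k₁, z₁, h₁⟩ := hdig l₁ hl₁ hl₁0
  obtain ⟨k₂, z₂, h₂⟩ := hdig l₂ hl₂ hl₂0
  have hz : b * (l₂ - l₁ - R * (k₁ - k₂)) = R ^ N * (R * (z₁ - z₂)) := by
    have : (b * (l₂ - l₁ - R * (k₁ - k₂)) : ℝ) = R ^ N * (R * (z₁ - z₂)) := by
      linear_combination h₁ - h₂
    exact_mod_cast this
  have hdvd := hN _ (Dvd.intro _ hz.symm)
  exact hmod (Int.modEq_iff_dvd.2 ((dvd_sub_left (dvd_mul_right R _)).1 hdvd))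

/-! ### Minimum principle for the energy. -/

lemma one_le_expEnergy {R b : ℤ} (hR : 2 ≤ |R|) (hR2 : Even R) (hb : b ≠ 0) {L : Finset ℤ}
    (hL : (0 : ℤ) ∈ L) {a : ℤ → ℂ} (ha : ∀ l ∈ L, a l ≠ 0) (ha0 : a 0 = 1)
    (h : HalfPeriodCondition R b L a)
    (hL2 : ∃ l₁ ∈ L, ∃ l₂ ∈ L, l₁ ≠ 0 ∧ l₂ ≠ 0 ∧ ¬ l₁ ≡ l₂ [ZMOD R])
    {μ : Measure ℝ} [IsProbabilityMeasure μ] (hμ : IsSelfAffine R {0, b} μ) (t : ℝ) :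
    1 ≤ expEnergy R L a μ t := by
  have hR0 : R ≠ 0 := by rintro rfl; norm_num at hR
  set E := expEnergy R L a μ with hE
  have hlsc : LowerSemicontinuous E := lowerSemicontinuous_expEnergy R L a μ
  -- The interval contains `t` and is stable under the walk: `(|x| + |l|)/|R| ≤ (ρ + ρ)/2 = ρ`.
  set ρ : ℝ := |t| + ∑ l ∈ L, |(l : ℝ)| with hρ
  have hsum0 : 0 ≤ ∑ l ∈ L, |(l : ℝ)| := Finset.sum_nonneg fun _ _ => abs_nonneg _
  have htK : t ∈ Set.Icc (-ρ) ρ := abs_le.1 (by linarith)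
  obtain ⟨s, hs, hmin⟩ := (hlsc.lowerSemicontinuousOn _).exists_isMinOn ⟨t, htK⟩ isCompact_Icc
  have h1 : E s ≤ E t := hmin htK
  -- The Bessel bound makes the minimum finite, as the strict comparison of sums in `ENNReal` below
  -- requires.
  have hfin : E s ≠ ⊤ := ne_top_of_le_ne_top ENNReal.one_ne_top <| by
    rw [← lintegral_enorm_expFun μ s]
    exact tsum_wordEnergy_le hR0 hb hL ha0 h hμ
      (continuous_expFun s).measurable (integrable_expFun μ s)
  have hmap : ∀ x ∈ Set.Icc (-ρ) ρ, ∀ l ∈ L, (R : ℝ)⁻¹ * (x - l) ∈ Set.Icc (-ρ) ρ := by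
    intro x hx l hl
    have hx' : |x| ≤ ρ := abs_le.2 hx
    have hl' : |(l : ℝ)| ≤ ρ := by
      have := Finset.single_le_sum (f := fun l : ℤ => |(l : ℝ)|) (fun _ _ => abs_nonneg _) hl
      linarith [abs_nonneg t]
    have hR1 : (2 : ℝ) ≤ |(R : ℝ)| := by exact_mod_cast hR
    refine abs_le.1 ?_
    rw [abs_mul, abs_inv]
    calc |(R : ℝ)|⁻¹ * |x - l| ≤ 2⁻¹ * (|x| + |(l : ℝ)|) := by
          gcongr
          exact abs_sub x l
      _ ≤ ρ := by linarith
  set M : Set ℝ := Set.Icc (-ρ) ρ ∩ E ⁻¹' Set.Iic (E s)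
  have h0 : (0 : ℝ) ∈ M := by
    refine zero_mem_of_invariant hR hR2 hb hL h.1 hL2
      (isClosed_Icc.inter (hlsc.isClosed_preimage _)) ⟨s, hs, le_refl (E s)⟩ ?_
    rintro x ⟨hxK, hx⟩ l hl hm
    refine ⟨hmap x hxK l hl, ?_⟩
    by_contra hcon
    have hlt : E s < E ((R : ℝ)⁻¹ * (x - l)) := not_le.1 hcon
    set p : ℤ → ENNReal := fun l => ‖a l‖ₑ ^ 2 * ‖mask b ((R : ℝ)⁻¹ * (x - l))‖ₑ ^ 2 with hp
    have hp1 : ∑ l ∈ L, p l = 1 := sum_enorm_sq_mask hR0 hb hL ha0 h hμ x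
    have hpl : p l ≠ 0 := mul_ne_zero (pow_ne_zero 2 (enorm_ne_zero.2 (ha l hl)))
      (pow_ne_zero 2 (enorm_ne_zero.2 hm))
    have hpt : ∀ l, p l ≠ ⊤ := fun l => ENNReal.mul_ne_top (ENNReal.pow_ne_top enorm_ne_top)
      (ENNReal.pow_ne_top enorm_ne_top)
    have hcontra : E s < E x := by
      calc E s = ∑ l ∈ L, p l * E s := by rw [← Finset.sum_mul, hp1, one_mul]
        _ = p l * E s + ∑ l ∈ L.erase l, p l * E s := (Finset.add_sum_erase _ _ hl).symm
        _ < p l * E ((R : ℝ)⁻¹ * (x - l)) +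
            ∑ l ∈ L.erase l, p l * E ((R : ℝ)⁻¹ * (x - l)) := by
          refine ENNReal.add_lt_add_of_lt_of_le ?_ ?_ (Finset.sum_le_sum fun k hk => ?_)
          · exact ENNReal.sum_ne_top.2 fun k _ => ENNReal.mul_ne_top (hpt k) hfin
          · exact (ENNReal.mul_lt_mul_iff_right hpl (hpt l)).2 hlt
          · exact mul_le_mul_right (hmin (hmap x hxK k (Finset.mem_of_mem_erase hk))) _
        _ = ∑ l ∈ L, p l * E ((R : ℝ)⁻¹ * (x - l)) :=
          Finset.add_sum_erase L (fun l => p l * E ((R : ℝ)⁻¹ * (x - l))) hl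
        _ = E x := (expEnergy_eq hR0 hb hL ha0 hμ x).symm
    exact absurd hx (not_le.2 hcontra)
  exact (one_le_expEnergy_zero R L a μ).trans (le_trans h0.2 h1)

/-! ### Transfer to `L²(μ)` and conclusion. -/

lemma enorm_sq_eq_lintegral {μ : Measure ℝ} (v : Lp ℂ 2 μ) :
    ‖v‖ₑ ^ 2 = ∫⁻ x, ‖v x‖ₑ ^ 2 ∂μ := by
  rw [Lp.enorm_def, eLpNorm_eq_lintegral_rpow_enorm_toReal (by norm_num) (by norm_num),
    ← ENNReal.rpow_natCast, ← ENNReal.rpow_mul]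
  norm_num

lemma enorm_sq_inner_weightedExpFamily (R : ℤ) (L : Finset ℤ) (a : ℤ → ℂ) (μ : Measure ℝ)
    [IsFiniteMeasure μ] (w : Words L) (v : Lp ℂ 2 μ) :
    ‖inner ℂ (weightedExpFamily R L a μ w) v‖ₑ ^ 2 = wordEnergy R L a μ v w := by
  have h : inner ℂ (expLp μ (wordFreq R w)) v = coeff μ (wordFreq R w) v := by
    rw [L2.inner_def]
    refine integral_congr_ae ?_
    filter_upwards [(memLp_expFun μ (wordFreq R w)).coeFn_toLp] with x hx
    rw [expLp, hx, RCLike.inner_apply, star_expFun, mul_comm]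
  rw [weightedExpFamily, inner_smul_left, h, enorm_mul, mul_pow, wordEnergy]
  congr 2
  rw [← ofReal_norm, RCLike.norm_conj, ofReal_norm]

theorem isParsevalFrame_weightedExpFamily {R b : ℤ} (hR : 2 ≤ |R|) (hR2 : Even R) (hb : b ≠ 0)
    {L : Finset ℤ} (hL : (0 : ℤ) ∈ L) {a : ℤ → ℂ} (ha : ∀ l ∈ L, a l ≠ 0) (ha0 : a 0 = 1)
    (h : HalfPeriodCondition R b L a)
    (hL2 : ∃ l₁ ∈ L, ∃ l₂ ∈ L, l₁ ≠ 0 ∧ l₂ ≠ 0 ∧ ¬ l₁ ≡ l₂ [ZMOD R])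
    {μ : Measure ℝ} [IsProbabilityMeasure μ] (hμ : IsSelfAffine R {0, b} μ) :
    IsParsevalFrame (weightedExpFamily R L a μ) := by
  have hR0 : R ≠ 0 := by rintro rfl; norm_num at hR
  refine isParsevalFrame_of_dense_span (fun v => ?_) (span_expLp_dense μ) ?_
  · simp_rw [enorm_sq_inner_weightedExpFamily, enorm_sq_eq_lintegral]
    exact tsum_wordEnergy_le hR0 hb hL ha0 h hμ (Lp.stronglyMeasurable v).measurable
      ((Lp.memLp v).integrable (by norm_num))
  · rintro _ ⟨t, rfl⟩
    have hae : expLp μ t =ᵐ[μ] expFun t := (memLp_expFun μ t).coeFn_toLp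
    have hcoeff : ∀ s, coeff μ s (expLp μ t) = coeff μ s (expFun t) := fun s =>
      integral_congr_ae (by filter_upwards [hae] with x hx; rw [hx])
    simp_rw [enorm_sq_inner_weightedExpFamily, enorm_sq_eq_lintegral, wordEnergy, hcoeff]
    rw [lintegral_congr_ae (by filter_upwards [hae] with x hx; rw [hx] :
      (fun x => ‖expLp μ t x‖ₑ ^ 2) =ᵐ[μ] fun x => ‖expFun t x‖ₑ ^ 2), lintegral_enorm_expFun]
    exact one_le_expEnergy hR hR2 hb hL ha ha0 h hL2 hμ t

end WeightedFourier

end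

theorem theorem5p6 (R b : ℤ) (hR : 2 ≤ |R|) (hb : b ≠ 0)
    (L : Finset ℤ) (hL : (0 : ℤ) ∈ L) (a : ℤ → ℂ) (ha : ∀ l ∈ L, a l ≠ 0) (ha0 : a 0 = 1) :
    (WeightedFourier.IsometryCondition R {0, b} L a ↔
        WeightedFourier.TwoDigitConditions R b L a) ∧
      (WeightedFourier.TwoDigitConditions R b L a →
        (∃ l₁ ∈ L, ∃ l₂ ∈ L, l₁ ≠ 0 ∧ l₂ ≠ 0 ∧ ¬ l₁ ≡ l₂ [ZMOD R]) →
        WeightedFourier.IsParsevalFrame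
          (WeightedFourier.weightedExpFamily R L a
            (WeightedFourier.selfAffineMeasure R {0, b}))) := by
  have hR0 : R ≠ 0 := by rintro rfl; norm_num at hR
  have hiff := WeightedFourier.twoDigitConditions_iff hR0 hb (L := L) (a := a)
  refine ⟨(WeightedFourier.isometryCondition_iff hR0 hb hL ha ha0).trans hiff.symm,
    fun h hL2 => ?_⟩
  have hR2 : Even R := by
    obtain ⟨⟨m, n, r, q, hm, -, rfl, -⟩, -⟩ := h
    exact (even_two.pow_of_ne_zero (by omega)).mul_right r
  have := WeightedFourier.isProbabilityMeasure_selfAffineMeasure (B := {0, b}) hR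
  exact WeightedFourier.isParsevalFrame_weightedExpFamily hR hR2 hb hL ha ha0 (hiff.1 h) hL2
    (WeightedFourier.isSelfAffine_selfAffineMeasure hR)
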